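/- Let $S^2\subset\mathbb{R}^3$ be the unit sphere with its round metric $g$. Off one point use the stereographic coordinate $z=x+iy\in\mathbb{C}$, where $z$ corresponds to the point $\frac{1}{q}(2x,2y,1-|z|^2)$ with $q:=1+|z|^2$ (so $z=\tan(\theta/2)e^{i\phi}$). Then $g=\frac{4}{q^2}(dx^2+dy^2)$; orient $S^2$ by $(\partial_x,\partial_y)$, with area form $\mathrm{vol}_g=\frac{4}{q^2}dx\wedge dy$, and let $v_1=\frac q2\partial_x$, $v_2=\frac q2\partial_y$ be the corresponding oriented orthonormal frame. In the trivialization of the spinor bundle induced by $(v_1,v_2)$ spinors are $\mathbb{C}^2$-valued functions, $v_1$ and $v_2$ act by the matrices $$\gamma_1=\begin{pmatrix}0&-i\\-i&0\end{pmatrix},\qquad \gamma_2=\begin{pmatrix}0&-1\\1&0\end{pmatrix},$$ the chirality operator is $\Gamma=i\gamma_1\gamma_2$, and $\psi^\pm:=\frac12(1\pm\Gamma)\psi$. The spin connection and the Kosmann–Lichnerowicz derivative along a vector field $X$ are $$\nabla_X\psi=\partial_X\psi+\tfrac14\sum_{i,j}g(\nabla_Xv_i,v_j)\,\gamma_i\gamma_j\psi,\qquad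 \mathscr{L}_X\psi=\nabla_X\psi-\tfrac18\sum_{i,j}\big[g(\nabla_{v_i}X,v_j)-g(\nabla_{v_j}X,v_i)\big]\gamma_i\gamma_j\psi,$$ with $\nabla$ on vector fields the Levi-Civita connection. For a smooth function $h:S^2\to\mathbb{R}$, the Hamiltonian vector field $X_h$ is defined by $dh=\mathrm{vol}_g(X_h,\cdot)$. The $L^2$ products $\langle\cdot,\cdot\rangle_{L^2}$ of spinors and of functions on $S^2$ are taken with respect to $\mathrm{vol}_g$ and are antilinear in the first entry. For $s,l,n$ all integers or all half-integers with $|s|,|n|\le l$, let $$Y^s_{l,n}(z)=(-1)^{\lfloor n\rfloor}\sqrt{\frac{2l+1}{4\pi}\,\frac{(l+n)!\,(l-n)!}{(l+s)!\,(l-s)!}}\;q^{-l}\sum_{r-k=n-s}\binom{l-s}{r}\binom{l+s}{k}z^r(-\bar z)^k$$ be the spin-weighted spherical harmonics, where $r,k$ are non-negative integers (for $s=0$ these are the usual spherical harmonics with the Condon–Shortley phase); put $Y^0_{l,n}:=0$ if $|n|>l$. For $l\in\{\frac12,\frac32,\dots\}$ and $n\in\{-l,-l+1,\dots,l\}$ let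 $$\psi_{l,n}=\frac1{\sqrt2}\begin{pmatrix}Y^{1/2}_{l,n}\\ i\,Y^{-1/2}_{l,n}\end{pmatrix}.$$ **Proposition.** For every smooth $h:S^2\to\mathbb{R}$, every $l\in\{\frac12,\frac32,\dots\}$, every $n\in\{-l,-l+1,\dots,l\}$ and each choice of sign $\pm$, the integrals below converge absolutely and $$\big\langle\psi^+_{l,n},\mathscr{L}_{X_h}\psi^+_{\frac12,\pm\frac12}\big\rangle_{L^2}-\big\langle\psi^-_{l,n},\mathscr{L}_{X_h}\psi^-_{\frac12,\pm\frac12}\big\rangle_{L^2}=c^\pm_{l,n}\,\big\langle Y^0_{l-\frac12,\,n\mp\frac12},\,h\big\rangle_{L^2},$$ where $$c^\pm_{l,n}=\frac i8\sqrt{\frac{l\pm n}{2\pi l}}\,\Big(l-\frac32\Big)\Big(l-\frac12\Big).$$ -/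

import Mathlib

open MeasureTheory
open scoped Manifold ContDiff Matrix

noncomputable section

namespace SpinSphere

/-! ### The round unit sphere in the stereographic coordinate -/

/-- The unit sphere in Euclidean three-space. -/
abbrev Sphere2 : Type := Metric.sphere (0 : EuclideanSpace ℝ (Fin (2 + 1))) 1

/-- The function `1 + |z|²`. -/
def q (z : ℂ) : ℝ := 1 + ‖z‖ ^ 2

lemma q_pos (z : ℂ) : 0 < q z := by
  unfold q; positivity

lemma q_eq (z : ℂ) : q z = 1 + (z.re ^ 2 + z.im ^ 2) := by
  rw [q, ← Complex.normSq_eq_norm_sq, Complex.normSq_apply]; ring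

/-- Inverse stereographic projection, as a vector of Euclidean three-space. In spherical
coordinates the image of `z` is the point with `z = tan (θ / 2) * exp (i φ)`. -/
def stereoVec (z : ℂ) : EuclideanSpace ℝ (Fin (2 + 1)) :=
  !₂[2 * z.re / q z, 2 * z.im / q z, (1 - ‖z‖ ^ 2) / q z]

lemma stereoVec_mem (z : ℂ) :
    stereoVec z ∈ Metric.sphere (0 : EuclideanSpace ℝ (Fin (2 + 1))) 1 := by
  have h := (q_pos z).ne'
  have hn : ‖z‖ ^ 2 = z.re ^ 2 + z.im ^ 2 := by
    rw [← Complex.normSq_eq_norm_sq, Complex.normSq_apply]; ring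
  rw [mem_sphere_zero_iff_norm, ← sq_eq_sq₀ (norm_nonneg _) zero_le_one,
    EuclideanSpace.norm_sq_eq]
  simp only [stereoVec, Real.norm_eq_abs, sq_abs, hn]
  simp [Fin.sum_univ_succ]
  field_simp
  rw [q_eq]; ring

/-- The oriented stereographic parametrization of the sphere minus one point. All tensors and
spinors below are written in the coordinate `z = x + i y` of this chart, whose image has full
measure. -/
def stereo (z : ℂ) : Sphere2 := ⟨stereoVec z, stereoVec_mem z⟩

/-- The round metric `(4 / q²) (dx² + dy²)`. The complex number `u` stands for the tangent vector
`u.re ∂_x + u.im ∂_y` at `z`. -/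
def metric (z u w : ℂ) : ℝ := 4 / q z ^ 2 * (u.re * w.re + u.im * w.im)

/-- The complex structure, `J ∂_x = ∂_y` and `J ∂_y = - ∂_x`. -/
def cplxStr (u : ℂ) : ℂ := Complex.I * u

/-- The area form `vol (u, w) = g (J u, w)`. -/
def areaForm (z u w : ℂ) : ℝ := metric z (cplxStr u) w

/-- The Riemannian measure `(4 / q²) dx dy`. -/
def sphereMeasure : Measure ℂ :=
  (volume : Measure ℂ).withDensity fun z => ENNReal.ofReal (4 / q z ^ 2)

/-- The coordinate frame `∂_x, ∂_y`. -/
def coordVec : Fin 2 → ℂ := ![1, Complex.I]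

/-- The components of a tangent vector in the coordinate frame. -/
def comp (i : Fin 2) (u : ℂ) : ℝ := ![u.re, u.im] i

/-- The coefficients `g_ij` of the metric. -/
def metricCoeff (i j : Fin 2) (z : ℂ) : ℝ := metric z (coordVec i) (coordVec j)

/-- The inverse matrix `g^ij` of the metric. -/
def metricInv (z : ℂ) : Matrix (Fin 2) (Fin 2) ℝ :=
  (Matrix.of fun i j => metricCoeff i j z)⁻¹

/-- The partial derivative `∂_i f`. -/
def partialDeriv (i : Fin 2) (f : ℂ → ℝ) (z : ℂ) : ℝ := fderiv ℝ f z (coordVec i)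

/-- The Christoffel symbols `Γ^k_ij` of the metric. -/
def christoffel (k i j : Fin 2) (z : ℂ) : ℝ :=
  1 / 2 * ∑ l, metricInv z k l *
    (partialDeriv i (metricCoeff j l) z + partialDeriv j (metricCoeff i l) z
      - partialDeriv l (metricCoeff i j) z)

/-- The Levi-Civita derivative `∇_u Y` at `z` of the vector field `Y` along the tangent
vector `u`. -/
def leviCivita (z u : ℂ) (Y : ℂ → ℂ) : ℂ :=
  fderiv ℝ Y z u +
    ∑ k, ((∑ i, ∑ j, christoffel k i j z * comp i u * comp j (Y z) : ℝ) : ℂ) * coordVec k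

/-- The oriented orthonormal frame `v₁ = (q / 2) ∂_x`, `v₂ = (q / 2) ∂_y`. -/
def frame (i : Fin 2) (z : ℂ) : ℂ := ((q z / 2 : ℝ) : ℂ) * coordVec i

/-- `X` is, in the stereographic coordinate, the Hamiltonian vector field of the function `h` on
the sphere: `dh = vol (X, ·)`. -/
def IsHamiltonianField (h : Sphere2 → ℝ) (X : ℂ → ℂ) : Prop :=
  ∀ z u : ℂ, fderiv ℝ (fun w => h (stereo w)) z u = areaForm z (X z) u

/-! ### Spinors -/

/-- A spinor field, written in the trivialization of the spinor bundle induced by `frame`. -/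
abbrev Spinor : Type := ℂ → Fin 2 → ℂ

/-- The gamma matrices; they are anti-hermitian and square to `-1`. -/
def gamma : Fin 2 → Matrix (Fin 2) (Fin 2) ℂ :=
  ![!![0, -Complex.I; -Complex.I, 0], !![0, -1; 1, 0]]

/-- The chirality operator `i v₁ · v₂ ·`. -/
def chirality : Matrix (Fin 2) (Fin 2) ℂ := Complex.I • (gamma 0 * gamma 1)

/-- The chiral component `ψ^σ = (1 + σ Γ) ψ / 2`, with `σ = 1` for `ψ⁺` and `σ = -1` for `ψ⁻`. -/
def chiralPart (σ : ℂ) (ψ : Spinor) : Spinor := fun z =>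
  (1 / 2 : ℂ) • ((1 + σ • chirality) *ᵥ ψ z)

/-- The lift of the Levi-Civita connection to spinors,
`∇_X ψ = ∂_X ψ + (1/4) ∑ g (∇_X v_i, v_j) v_i · v_j · ψ`. -/
def spinDeriv (X : ℂ → ℂ) (ψ : Spinor) : Spinor := fun z =>
  fderiv ℝ ψ z (X z) +
    (1 / 4 : ℂ) • ∑ i, ∑ j,
      ((metric z (leviCivita z (X z) (frame i)) (frame j z) : ℝ) : ℂ) •
        ((gamma i * gamma j) *ᵥ ψ z)

/-- The Kosmann-Lichnerowicz derivative
`L_X ψ = ∇_X ψ - (1/8) ∑ (g (∇_{v_i} X, v_j) - g (∇_{v_j} X, v_i)) v_i · v_j · ψ`. -/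
def kosmannDeriv (X : ℂ → ℂ) (ψ : Spinor) : Spinor := fun z =>
  spinDeriv X ψ z -
    (1 / 8 : ℂ) • ∑ i, ∑ j,
      ((metric z (leviCivita z (frame i z) X) (frame j z)
        - metric z (leviCivita z (frame j z) X) (frame i z) : ℝ) : ℂ) •
        ((gamma i * gamma j) *ᵥ ψ z)

/-- The pointwise hermitian pairing of spinors, antilinear in the first entry. -/
def spinorPairing (ψ₁ ψ₂ : Spinor) (z : ℂ) : ℂ := star (ψ₁ z) ⬝ᵥ ψ₂ z

/-- The `L²` product of spinors. -/
def spinorL2 (ψ₁ ψ₂ : Spinor) : ℂ := ∫ z, spinorPairing ψ₁ ψ₂ z ∂sphereMeasure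

/-- The `L²` product of complex functions, antilinear in the first entry. -/
def scalarL2 (f₁ f₂ : ℂ → ℂ) : ℂ := ∫ z, star (f₁ z) * f₂ z ∂sphereMeasure

/-! ### Spin-weighted spherical harmonics and eigenspinors -/

/-- The spin-weighted spherical harmonic `Y^s_{l,n}` in the stereographic coordinate and frame,
where `s`, `l`, `n` are all integers or all half-integers and `|s|, |n| ≤ l`:
`(-1)^⌊n⌋ √((2l+1)/(4π) · (l+n)! (l-n)! / ((l+s)! (l-s)!)) · q^{-l} ·`
`∑_{r - k = n - s} C(l-s, r) C(l+s, k) z^r (-z̄)^k`.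
For `s = 0` these are the usual spherical harmonics with the Condon-Shortley phase. -/
def spinHarmonic (s l n : ℝ) (z : ℂ) : ℂ :=
  (((-1 : ℝ) ^ ⌊n⌋ *
      √((2 * l + 1) / (4 * Real.pi) *
        ((⌊l + n⌋₊.factorial * ⌊l - n⌋₊.factorial : ℝ) /
          (⌊l + s⌋₊.factorial * ⌊l - s⌋₊.factorial : ℝ))) *
      q z ^ (-l) : ℝ) : ℂ) *
    ∑ r ∈ Finset.range (⌊l - s⌋₊ + 1), ∑ k ∈ Finset.range (⌊l + s⌋₊ + 1),
      if (r : ℝ) - (k : ℝ) = n - s then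
        ((⌊l - s⌋₊.choose r : ℂ) * (⌊l + s⌋₊.choose k : ℂ)) * z ^ r * (-star z) ^ k
      else 0

/-- The scalar spherical harmonic `Y⁰_{l,n}`. -/
def sphHarmonic (l n : ℝ) : ℂ → ℂ := spinHarmonic 0 l n

/-- The eigenspinor `ψ_{l,n} = (Y⁺_{l,n}, i Y⁻_{l,n}) / √2`, where `Y^±` has spin weight `±1/2`. -/
def eigenspinor (l n : ℝ) : Spinor := fun z =>
  ((1 / √2 : ℝ) : ℂ) •
    ![spinHarmonic (1 / 2) l n z, Complex.I * spinHarmonic (-(1 / 2)) l n z]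

end SpinSphere

end

noncomputable section

namespace SpinSphere

/-! Everything is reduced to one integration by parts on the plane. Let `F` be `h` in the coordinate
`z`, `∂ = dz`, `∂̄ = dzbar` and `L = l - 1/2`. For real `h` the Hamiltonian field is `X = -(i/2) q²
∂̄F`. In the given spin frame the connection terms of the Kosmann derivative cancel, so it acts as
`∂_X` plus a multiple of `Im ∂X` with opposite signs on the two chiralities (`kosmannDeriv_eq`). The
spinors with `l = 1/2` are proportional to `(c₀ + c₁ z̄) q^(-1/2)` and `(c₀ z - c₁) q^(-1/2)`, with
`(c₀, c₁)` equal to `(1, 0)` or `(0, 1)`. On them the derivative involves only `∂F`, respectively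
`∂̄F`, and `∂∂̄F` (`kosmannDeriv_pos`, `kosmannDeriv_neg`).

Up to normalization, `Y^s_{l,n}` is `q^(-l)` times the coefficient of `t^(l+n)` in `(1 + z t)^(l-s)
(t - z̄)^(l+s)`. Such a coefficient is a fixed linear combination of values at integers `t`, with
the same weights for both spinor components and for the scalar harmonic, whose polynomial is `(c₀ t
- c₁) (1 + z t)^L (t - z̄)^L` (`exists_harmonic_weights`). So it suffices to treat each fixed `t`,
where the claim becomes `integral_posInt_sub_negInt`.

There, since `(c₀ + c₁ z̄)(t - z) + (c₀ z - c₁)(1 + z̄ t) = (c₀ t - c₁) q`, the second-order terms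
combine to `-(c₀ t - c₁) m ∂∂̄F` with `m = q^(-L) (1 + z̄ t)^L (t - z)^L`. As `∂∂̄m = -L(L+1) q⁻²
m`, they contribute `L(L+1)` times the scalar integral. The first-order terms contribute `-2L` after
integration by parts, and the sum is `L(L-1) = (l - 1/2)(l - 3/2)`.

There is no boundary term at infinity: `F` is smooth in `z⁻¹` there, so `F`, `∂F` and `∂̄F`, `∂∂̄F`
are of order `1`, `1/q`, `1/q²` (`exists_wirtinger_decay`), and the fields that occur are of order
`1/q` (`integral_wirtinger_div_eq_zero`). -/

/-! ### Wirtinger derivatives -/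

/-- The Wirtinger derivative `∂g/∂z`. -/
def dz (g : ℂ → ℂ) (z : ℂ) : ℂ := (fderiv ℝ g z 1 - Complex.I * fderiv ℝ g z Complex.I) / 2

/-- The Wirtinger derivative `∂g/∂z̄`. -/
def dzbar (g : ℂ → ℂ) (z : ℂ) : ℂ := (fderiv ℝ g z 1 + Complex.I * fderiv ℝ g z Complex.I) / 2

/-- The real linear map `u ↦ a u + b ū`. -/
def wirt (a b : ℂ) : ℂ →L[ℝ] ℂ :=
  a • ContinuousLinearMap.id ℝ ℂ + b • (Complex.conjCLE : ℂ →L[ℝ] ℂ)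

lemma wirt_apply (a b u : ℂ) : wirt a b u = a * u + b * star u := by
  simp [wirt]

/-- `g` is real differentiable at `z`, with Wirtinger derivatives `a` and `b`. -/
def HasWirt (g : ℂ → ℂ) (a b z : ℂ) : Prop := HasFDerivAt g (wirt a b) z

lemma HasWirt.hasFDerivAt {g : ℂ → ℂ} {a b z : ℂ} (h : HasWirt g a b z) :
    HasFDerivAt g (wirt a b) z := h

lemma HasWirt.congr_of_eventuallyEq {f g : ℂ → ℂ} {a b z : ℂ} (h : HasWirt g a b z)
    (hfg : f =ᶠ[nhds z] g) : HasWirt f a b z :=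
  h.hasFDerivAt.congr_of_eventuallyEq hfg

lemma HasWirt.dz_eq {g : ℂ → ℂ} {a b z : ℂ} (h : HasWirt g a b z) :
    dz g z = a := by
  rw [dz, h.hasFDerivAt.fderiv, wirt_apply, wirt_apply]
  simp
  linear_combination (-(a - b) / 2) * Complex.I_sq

lemma HasWirt.dzbar_eq {g : ℂ → ℂ} {a b z : ℂ} (h : HasWirt g a b z) :
    dzbar g z = b := by
  rw [dzbar, h.hasFDerivAt.fderiv, wirt_apply, wirt_apply]
  simp
  linear_combination ((a - b) / 2) * Complex.I_sq

lemma fderiv_eq_wirt (g : ℂ → ℂ) (z : ℂ) : fderiv ℝ g z = wirt (dz g z) (dzbar g z) := by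
  have hu : ∀ u : ℂ, fderiv ℝ g z u
      = u.re * fderiv ℝ g z 1 + u.im * fderiv ℝ g z Complex.I := by
    intro u
    have : u = u.re • (1 : ℂ) + u.im • Complex.I := by simp
    conv_lhs => rw [this]
    rw [map_add, map_smul, map_smul]
    simp
  ext u
  rw [hu, wirt_apply, dz, dzbar, ← starRingEnd_apply]
  obtain ⟨x, y⟩ := u
  have e1 : (⟨x, y⟩ : ℂ) = x + y * Complex.I := by apply Complex.ext <;> simp
  have e2 : (starRingEnd ℂ) ⟨x, y⟩ = x - y * Complex.I := by apply Complex.ext <;> simp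
  rw [e1, ← e1, e2, e1]
  simp
  linear_combination (y * fderiv ℝ g z Complex.I) * Complex.I_sq

lemma hasWirt {g : ℂ → ℂ} {z : ℂ} (h : DifferentiableAt ℝ g z) :
    HasWirt g (dz g z) (dzbar g z) z := by
  rw [HasWirt, ← fderiv_eq_wirt]; exact h.hasFDerivAt

lemma hasWirt_id (z : ℂ) : HasWirt (fun w : ℂ => w) 1 0 z := by
  unfold HasWirt
  convert! hasFDerivAt_id (𝕜 := ℝ) z using 1
  ext u; simp [wirt_apply]

lemma hasWirt_star (z : ℂ) : HasWirt (fun w : ℂ => star w) 0 1 z := by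
  unfold HasWirt
  convert! (Complex.conjCLE : ℂ →L[ℝ] ℂ).hasFDerivAt using 1
  ext u; simp [wirt_apply]

lemma hasWirt_const (c z : ℂ) : HasWirt (fun _ : ℂ => c) 0 0 z := by
  unfold HasWirt
  convert! hasFDerivAt_const (𝕜 := ℝ) c z using 1
  ext u; simp [wirt_apply]

lemma HasWirt.add {f g : ℂ → ℂ} {a b c d z : ℂ} (hf : HasWirt f a b z)
    (hg : HasWirt g c d z) :
    HasWirt (fun w => f w + g w) (a + c) (b + d) z := by
  unfold HasWirt
  convert! hf.hasFDerivAt.fun_add hg.hasFDerivAt using 1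
  ext u; simp [wirt_apply]; ring

lemma HasWirt.sub {f g : ℂ → ℂ} {a b c d z : ℂ} (hf : HasWirt f a b z)
    (hg : HasWirt g c d z) :
    HasWirt (fun w => f w - g w) (a - c) (b - d) z := by
  unfold HasWirt
  convert! hf.hasFDerivAt.fun_sub hg.hasFDerivAt using 1
  ext u; simp [wirt_apply]; ring

lemma HasWirt.mul {f g : ℂ → ℂ} {a b c d z : ℂ} (hf : HasWirt f a b z)
    (hg : HasWirt g c d z) :
    HasWirt (fun w => f w * g w) (f z * c + a * g z) (f z * d + b * g z) z := by
  unfold HasWirt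
  convert! hf.hasFDerivAt.fun_mul hg.hasFDerivAt using 1
  ext u; simp [wirt_apply]; ring

lemma HasWirt.comp_holo {f φ : ℂ → ℂ} {a b c z : ℂ}
    (hf : HasWirt f a b (φ z)) (hφ : HasDerivAt φ c z) :
    HasWirt (fun w => f (φ w)) (a * c) (b * star c) z := by
  unfold HasWirt
  convert! hf.hasFDerivAt.comp z (hφ.hasFDerivAt.restrictScalars ℝ) using 1
  ext u; simp [wirt_apply]; ring

lemma HasWirt.holo_comp {f φ : ℂ → ℂ} {a b c z : ℂ}
    (hφ : HasDerivAt φ c (f z)) (hf : HasWirt f a b z) :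
    HasWirt (fun w => φ (f w)) (c * a) (c * b) z := by
  unfold HasWirt
  convert! (hφ.hasFDerivAt.restrictScalars ℝ).comp z hf.hasFDerivAt using 1
  ext u; simp [wirt_apply]; ring

lemma HasWirt.pow {f : ℂ → ℂ} {a b z : ℂ} (k : ℕ) (hf : HasWirt f a b z) :
    HasWirt (fun w => f w ^ k) (k * f z ^ (k - 1) * a) (k * f z ^ (k - 1) * b) z :=
  HasWirt.holo_comp (hasDerivAt_pow k (f z)) hf

lemma HasWirt.inv {f : ℂ → ℂ} {a b z : ℂ} (h0 : f z ≠ 0)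
    (hf : HasWirt f a b z) :
    HasWirt (fun w => (f w)⁻¹) (-(f z ^ 2)⁻¹ * a) (-(f z ^ 2)⁻¹ * b) z :=
  HasWirt.holo_comp (hasDerivAt_inv h0) hf

lemma ContDiff.dz {g : ℂ → ℂ} {m n : WithTop ℕ∞} (hg : ContDiff ℝ n g) (h : m + 1 ≤ n) :
    ContDiff ℝ m (dz g) := by
  have h1 : ∀ v : ℂ, ContDiff ℝ m fun z => fderiv ℝ g z v := fun v =>
    (hg.fderiv_right h).clm_apply contDiff_const
  exact ((h1 1).sub (contDiff_const.mul (h1 _))).div_const _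

lemma ContDiff.dzbar {g : ℂ → ℂ} {m n : WithTop ℕ∞} (hg : ContDiff ℝ n g) (h : m + 1 ≤ n) :
    ContDiff ℝ m (dzbar g) := by
  have h1 : ∀ v : ℂ, ContDiff ℝ m fun z => fderiv ℝ g z v := fun v =>
    (hg.fderiv_right h).clm_apply contDiff_const
  exact ((h1 1).add (contDiff_const.mul (h1 _))).div_const _

/-! ### Integration by parts on the plane -/

lemma integral_mul_fderiv_of_hasCompactSupport {χ G : ℂ → ℂ} (hχ : ContDiff ℝ 1 χ)
    (hG : ContDiff ℝ 1 G) (hc : HasCompactSupport χ) (v : ℂ) :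
    Integrable (fun z => χ z * fderiv ℝ G z v) ∧ Integrable (fun z => fderiv ℝ χ z v * G z) ∧
      ∫ z, χ z * fderiv ℝ G z v = -∫ z, fderiv ℝ χ z v * G z := by
  have cG : Continuous fun z => fderiv ℝ G z v :=
    (hG.continuous_fderiv one_ne_zero).clm_apply continuous_const
  have cχ : Continuous fun z => fderiv ℝ χ z v :=
    (hχ.continuous_fderiv one_ne_zero).clm_apply continuous_const
  have i1 : Integrable (fun z => χ z * fderiv ℝ G z v) :=
    (hχ.continuous.mul cG).integrable_of_hasCompactSupport hc.mul_right
  have i2 : Integrable (fun z => fderiv ℝ χ z v * G z) :=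
    (cχ.mul hG.continuous).integrable_of_hasCompactSupport
      (HasCompactSupport.mul_right (hc.fderiv_apply ℝ v))
  have i3 : Integrable (fun z => χ z * G z) :=
    (hχ.continuous.mul hG.continuous).integrable_of_hasCompactSupport hc.mul_right
  exact ⟨i1, i2, integral_mul_fderiv_eq_neg_fderiv_mul_of_integrable i2 i1 i3
    (fun x _ => (hχ.differentiable one_ne_zero) x) (fun x _ => (hG.differentiable one_ne_zero) x)⟩

lemma integral_wirtinger_comb {a b c d : ℂ → ℂ} (ha : Integrable a) (hb : Integrable b)
    (hc : Integrable c) (hd : Integrable d) :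
    ∫ z, ((1 / 2) * a z - (Complex.I / 2) * b z + ((1 / 2) * c z + (Complex.I / 2) * d z)) =
      (1 / 2) * (∫ z, a z) - (Complex.I / 2) * (∫ z, b z) +
        ((1 / 2) * (∫ z, c z) + (Complex.I / 2) * ∫ z, d z) := by
  simp only [← integral_const_mul]
  rw [← integral_sub (ha.const_mul _) (hb.const_mul _),
    ← integral_add (hc.const_mul _) (hd.const_mul _)]
  exact integral_add ((ha.const_mul _).sub (hb.const_mul _)) ((hc.const_mul _).add (hd.const_mul _))

lemma integral_mul_wirtinger_div {χ G H : ℂ → ℂ} (hχ : ContDiff ℝ 1 χ)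
    (hG : ContDiff ℝ 1 G) (hH : ContDiff ℝ 1 H) (hc : HasCompactSupport χ) :
    ∫ z, χ z * (dz G z + dzbar H z) = -∫ z, (dz χ z * G z + dzbar χ z * H z) := by
  obtain ⟨a1, b1, e1⟩ := integral_mul_fderiv_of_hasCompactSupport hχ hG hc 1
  obtain ⟨a2, b2, e2⟩ := integral_mul_fderiv_of_hasCompactSupport hχ hG hc Complex.I
  obtain ⟨a3, b3, e3⟩ := integral_mul_fderiv_of_hasCompactSupport hχ hH hc 1
  obtain ⟨a4, b4, e4⟩ := integral_mul_fderiv_of_hasCompactSupport hχ hH hc Complex.I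
  have hl : ∀ z, χ z * (dz G z + dzbar H z) =
      (1 / 2) * (χ z * fderiv ℝ G z 1) - (Complex.I / 2) * (χ z * fderiv ℝ G z Complex.I) +
      ((1 / 2) * (χ z * fderiv ℝ H z 1) + (Complex.I / 2) * (χ z * fderiv ℝ H z Complex.I)) := by
    intro z; rw [dz, dzbar]; ring
  have hr : ∀ z, dz χ z * G z + dzbar χ z * H z =
      (1 / 2) * (fderiv ℝ χ z 1 * G z) - (Complex.I / 2) * (fderiv ℝ χ z Complex.I * G z) +
      ((1 / 2) * (fderiv ℝ χ z 1 * H z) + (Complex.I / 2) * (fderiv ℝ χ z Complex.I * H z)) := by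
    intro z; rw [dz, dzbar]; ring
  simp_rw [hl, hr]
  rw [integral_wirtinger_comb a1 a2 a3 a4, integral_wirtinger_comb b1 b2 b3 b4, e1, e2, e3, e4]
  ring

lemma norm_dz_le (g : ℂ → ℂ) (z : ℂ) : ‖dz g z‖ ≤ ‖fderiv ℝ g z‖ := by
  have h1 := (fderiv ℝ g z).le_opNorm 1
  have h2 := (fderiv ℝ g z).le_opNorm Complex.I
  have h3 := norm_sub_le (fderiv ℝ g z 1) (Complex.I * fderiv ℝ g z Complex.I)
  rw [dz, norm_div]
  simp at *
  linarith

lemma norm_dzbar_le (g : ℂ → ℂ) (z : ℂ) : ‖dzbar g z‖ ≤ ‖fderiv ℝ g z‖ := by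
  have h1 := (fderiv ℝ g z).le_opNorm 1
  have h2 := (fderiv ℝ g z).le_opNorm Complex.I
  have h3 := norm_add_le (fderiv ℝ g z 1) (Complex.I * fderiv ℝ g z Complex.I)
  rw [dzbar, norm_div]
  simp at *
  linarith

/-- Smooth cutoffs whose derivatives decay like `1 / (1 + |z|)`, uniformly. -/
lemma exists_cutoff : ∃ (χ : ℕ → ℂ → ℂ) (K : ℝ), (∀ n, ContDiff ℝ 1 (χ n)) ∧
    (∀ n, HasCompactSupport (χ n)) ∧ (∀ n z, ‖χ n z‖ ≤ 1) ∧
    (∀ n z, ‖fderiv ℝ (χ n) z‖ ≤ K / (1 + ‖z‖)) ∧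
    (∀ n z, ‖fderiv ℝ (χ n) z‖ ≤ K / (n + 1)) ∧
    (∀ z, Filter.Tendsto (fun n => χ n z) Filter.atTop (nhds 1)) := by
  let φ : ContDiffBump (0 : ℂ) := ⟨1, 2, by norm_num, by norm_num⟩
  let ψ : ℂ → ℂ := fun z => (φ z : ℂ)
  have hψ : ContDiff ℝ 1 ψ := Complex.ofRealCLM.contDiff.comp φ.contDiff
  have hψc : HasCompactSupport ψ := φ.hasCompactSupport.comp_left Complex.ofReal_zero
  obtain ⟨K, hK⟩ := (hψc.fderiv (𝕜 := ℝ)).exists_bound_of_continuous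
    (hψ.continuous_fderiv one_ne_zero)
  have hK0 : 0 ≤ K := (norm_nonneg _).trans (hK 0)
  let s : ℕ → ℝ := fun n => ((n : ℝ) + 1)⁻¹
  have hs : ∀ n, 0 < s n := fun n => by positivity
  have hs1 : ∀ n, s n ≤ 1 := fun n => inv_le_one_of_one_le₀ (by linarith [n.cast_nonneg (α := ℝ)])
  have hfd : ∀ n z, fderiv ℝ (fun z => ψ (s n • z)) z = s n • fderiv ℝ ψ (s n • z) := by
    intro n z
    exact fderiv_comp_smul (s n)
  have hb : ∀ n z, ‖fderiv ℝ (fun z => ψ (s n • z)) z‖ ≤ s n * K := by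
    intro n z
    rw [hfd, norm_smul, Real.norm_of_nonneg (hs n).le]
    exact mul_le_mul_of_nonneg_left (hK _) (hs n).le
  refine ⟨fun n z => ψ (s n • z), 3 * K, fun n => hψ.comp (contDiff_const_smul _), fun n => ?_,
    fun n z => ?_, fun n z => ?_, fun n z => ?_, fun z => ?_⟩
  · exact hψc.comp_homeomorph (Homeomorph.smulOfNeZero (s n) (hs n).ne')
  · simp only [ψ, Complex.norm_real, Real.norm_of_nonneg φ.nonneg]
    exact φ.le_one
  · rw [le_div_iff₀ (by positivity)]
    -- The bump has support of radius 2, so the derivative vanishes once `s n * ‖z‖ > 2`. Otherwise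
    -- `s n * (1 + ‖z‖) ≤ 1 + 2`, whence the factor 3.
    by_cases hz : s n * ‖z‖ ≤ 2
    · calc _ ≤ s n * K * (1 + ‖z‖) := by gcongr; exact hb n z
        _ = K * (s n + s n * ‖z‖) := by ring
        _ ≤ K * (1 + 2) := by gcongr; exact hs1 n
        _ = _ := by ring
    · have : fderiv ℝ ψ (s n • z) = 0 := by
        apply image_eq_zero_of_notMem_tsupport
        intro h
        have h1 : s n • z ∈ tsupport ψ := tsupport_fderiv_subset ℝ h
        have h2 : tsupport ψ ⊆ tsupport φ := closure_mono (by
          intro x hx hx'; apply hx; simp [ψ, hx'])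
        have h3 := h2 h1
        rw [φ.tsupport_eq] at h3
        simp [abs_of_pos (hs n)] at h3
        exact hz h3
      rw [hfd, this]
      simp; positivity
  · refine (hb n z).trans ?_
    rw [div_eq_inv_mul]
    show s n * K ≤ s n * (3 * K)
    have := hs n
    gcongr; linarith
  · have h1 : Filter.Tendsto (fun n : ℕ => s n • z) Filter.atTop (nhds ((0 : ℝ) • z)) := by
      apply Filter.Tendsto.smul_const
      simpa [s, one_div] using tendsto_one_div_add_atTop_nhds_zero_nat (𝕜 := ℝ)
    have h2 := (hψ.continuous.tendsto ((0 : ℝ) • z)).comp h1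
    have h3 : ψ ((0 : ℝ) • z) = 1 := by
      simp only [ψ, zero_smul]
      rw [φ.one_of_mem_closedBall (by simp [φ])]; simp
    rwa [h3] at h2

lemma sqrt_q_le (z : ℂ) : √(q z) ≤ 1 + ‖z‖ := by
  rw [Real.sqrt_le_left (by positivity), q]
  nlinarith [norm_nonneg z]

lemma continuous_q : Continuous q := by unfold q; fun_prop

/-- Convergence holds because the decay order 3 exceeds the real dimension 2. The function is the
product of the decay `1/q` of a field and the decay `q^(-1/2)` of the cutoff derivatives, and it is
the common integrable bound below. -/
lemma integrable_inv_q_mul_sqrt : Integrable fun z : ℂ => (q z * √(q z))⁻¹ := by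
  have h := integrable_rpow_neg_one_add_norm_sq (E := ℂ) (μ := volume) (r := 3)
    (by rw [Complex.finrank_real_complex]; norm_num)
  refine h.congr (Filter.Eventually.of_forall fun z => ?_)
  have h0 := q_pos z
  show (q z) ^ (-3 / 2 : ℝ) = _
  rw [show (-3 / 2 : ℝ) = -(1 + 1 / 2) by norm_num, Real.rpow_neg h0.le, Real.rpow_add h0,
    Real.rpow_one, ← Real.sqrt_eq_rpow]

/-- The divergence theorem for a vector field on the plane that decays like `1 / q`. -/
theorem integral_wirtinger_div_eq_zero {G H : ℂ → ℂ} (hG : ContDiff ℝ 1 G) (hH : ContDiff ℝ 1 H)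
    {C : ℝ} (hGb : ∀ z, ‖G z‖ ≤ C / q z) (hHb : ∀ z, ‖H z‖ ≤ C / q z)
    (hint : Integrable fun z => dz G z + dzbar H z) : ∫ z, (dz G z + dzbar H z) = 0 := by
  obtain ⟨χ, K, h1, h2, h3, h4, h5, h6⟩ := exists_cutoff
  have hC : 0 ≤ C := by
    have := (norm_nonneg _).trans (hGb 0)
    simpa [q] using this
  have hK : 0 ≤ K := by
    have := (norm_nonneg _).trans (h4 0 0)
    simpa using this
  have hl : Filter.Tendsto (fun n => ∫ z, χ n z * (dz G z + dzbar H z)) Filter.atTop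
      (nhds (∫ z, (dz G z + dzbar H z))) := by
    refine tendsto_integral_of_dominated_convergence _ (fun n => ?_) hint.norm (fun n => ?_) ?_
    · exact (h1 n).continuous.aestronglyMeasurable.mul hint.1
    · refine Filter.Eventually.of_forall fun z => ?_
      rw [norm_mul]
      exact mul_le_of_le_one_left (norm_nonneg _) (h3 n z)
    · refine Filter.Eventually.of_forall fun z => ?_
      simpa using (h6 z).mul_const (dz G z + dzbar H z)
  have hbound : ∀ n z, ‖dz (χ n) z * G z + dzbar (χ n) z * H z‖ ≤
      2 * (‖fderiv ℝ (χ n) z‖ * (C / q z)) := by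
    intro n z
    refine (norm_add_le _ _).trans ?_
    rw [norm_mul, norm_mul, two_mul]
    gcongr
    · exact norm_dz_le _ _
    · exact hGb z
    · exact norm_dzbar_le _ _
    · exact hHb z
  have hr : Filter.Tendsto (fun n => ∫ z, (dz (χ n) z * G z + dzbar (χ n) z * H z)) Filter.atTop
      (nhds (∫ _ : ℂ, (0 : ℂ))) := by
    refine tendsto_integral_of_dominated_convergence _ (fun n => ?_)
      (integrable_inv_q_mul_sqrt.const_mul (2 * K * C)) (fun n => ?_) ?_
    · exact ((((ContDiff.dz (h1 n) (m := 0) (by norm_num)).continuous.mul hG.continuous).add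
        ((ContDiff.dzbar (h1 n) (m := 0) (by norm_num)).continuous.mul
          hH.continuous))).aestronglyMeasurable
    · refine Filter.Eventually.of_forall fun z => ?_
      refine (hbound n z).trans ?_
      have hq := q_pos z
      have hsq : 0 < √(q z) := Real.sqrt_pos.2 hq
      have : ‖fderiv ℝ (χ n) z‖ ≤ K / √(q z) :=
        (h4 n z).trans (by gcongr; exact sqrt_q_le z)
      calc _ ≤ 2 * (K / √(q z) * (C / q z)) := by gcongr
        _ = _ := by field_simp
    · refine Filter.Eventually.of_forall fun z => ?_
      -- The bound on the cutoff derivatives that is uniform in `z` gives the pointwise limit; the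
      -- one that decays in `z` gave the domination.
      apply squeeze_zero_norm (a := fun n : ℕ => 2 * (K * (1 / ((n : ℝ) + 1)) * (C / q z)))
      · intro n
        refine (hbound n z).trans ?_
        have hq := q_pos z
        gcongr
        simpa [div_eq_mul_inv] using h5 n z
      · have := (((tendsto_one_div_add_atTop_nhds_zero_nat (𝕜 := ℝ)).const_mul K).mul_const
          (C / q z)).const_mul 2
        simpa using this
  have he : ∀ n, ∫ z, χ n z * (dz G z + dzbar H z)
      = -∫ z, (dz (χ n) z * G z + dzbar (χ n) z * H z) :=
    fun n => integral_mul_wirtinger_div (h1 n) hG hH (h2 n)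
  simp_rw [he] at hl
  have := tendsto_nhds_unique hl hr.neg
  simpa using this

/-! ### Functions on the sphere in the stereographic coordinate -/

/-- A function on the sphere in the stereographic coordinate, with complex values. -/
def pullback (h : Sphere2 → ℝ) (z : ℂ) : ℂ := ((h (stereo z) : ℝ) : ℂ)

lemma contDiff_q : ContDiff ℝ ∞ q := by
  have : q = fun z : ℂ => 1 + (z.re ^ 2 + z.im ^ 2) := funext q_eq
  rw [this]
  exact contDiff_const.add ((Complex.reCLM.contDiff.pow 2).add (Complex.imCLM.contDiff.pow 2))

lemma contDiff_div_q {g : ℂ → ℝ} (hg : ContDiff ℝ ∞ g) : ContDiff ℝ ∞ fun z => g z / q z :=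
  hg.div contDiff_q fun z => (q_pos z).ne'

lemma contDiff_euclid_three {a b c : ℂ → ℝ} (ha : ContDiff ℝ ∞ a) (hb : ContDiff ℝ ∞ b)
    (hc : ContDiff ℝ ∞ c) :
    ContDiff ℝ ∞ fun z => (!₂[a z, b z, c z] : EuclideanSpace ℝ (Fin (2 + 1))) := by
  rw [contDiff_euclidean]
  intro i
  fin_cases i
  · simpa using ha
  · simpa using hb
  · simpa using hc

lemma contDiff_comp_sphere {h : Sphere2 → ℝ} (hh : ContMDiff (𝓡 2) 𝓘(ℝ, ℝ) ∞ h)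
    {f : ℂ → EuclideanSpace ℝ (Fin (2 + 1))} (hf : ContDiff ℝ ∞ f)
    (hf' : ∀ z, f z ∈ Metric.sphere (0 : EuclideanSpace ℝ (Fin (2 + 1))) 1) :
    ContDiff ℝ ∞ fun z => ((h ⟨f z, hf' z⟩ : ℝ) : ℂ) := by
  have : Fact (Module.finrank ℝ (EuclideanSpace ℝ (Fin (2 + 1))) = 2 + 1) :=
    ⟨finrank_euclideanSpace_fin⟩
  have h1 : ContMDiff 𝓘(ℝ, ℂ) (𝓡 2) ∞ (Set.codRestrict f _ hf') :=
    ContMDiff.codRestrict_sphere hf.contMDiff hf'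
  exact Complex.ofRealCLM.contDiff.comp (hh.comp h1).contDiff

lemma contDiff_pullback {h : Sphere2 → ℝ} (hh : ContMDiff (𝓡 2) 𝓘(ℝ, ℝ) ∞ h) :
    ContDiff ℝ ∞ (pullback h) := by
  refine contDiff_comp_sphere hh (f := stereoVec) ?_ stereoVec_mem
  exact contDiff_euclid_three
    (contDiff_div_q (contDiff_const.mul Complex.reCLM.contDiff))
    (contDiff_div_q (contDiff_const.mul Complex.imCLM.contDiff))
    (contDiff_div_q (contDiff_const.sub (contDiff_norm_sq ℝ)))

/-- The stereographic parametrization from the opposite pole, composed with conjugation, so that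
the transition map is `z ↦ z⁻¹`. -/
def stereoInvVec (z : ℂ) : EuclideanSpace ℝ (Fin (2 + 1)) :=
  !₂[2 * z.re / q z, (-2) * z.im / q z, (‖z‖ ^ 2 - 1) / q z]

lemma stereoInvVec_mem (z : ℂ) :
    stereoInvVec z ∈ Metric.sphere (0 : EuclideanSpace ℝ (Fin (2 + 1))) 1 := by
  have h := stereoVec_mem z
  rw [mem_sphere_zero_iff_norm, ← sq_eq_sq₀ (norm_nonneg _) zero_le_one,
    EuclideanSpace.norm_sq_eq] at *
  simp only [stereoVec, stereoInvVec, Real.norm_eq_abs, sq_abs] at *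
  simp [Fin.sum_univ_succ] at *
  linear_combination h

lemma stereoVec_eq_stereoInvVec {z : ℂ} (hz : z ≠ 0) : stereoVec z = stereoInvVec z⁻¹ := by
  have h1 : ‖z‖ ≠ 0 := norm_ne_zero_iff.2 hz
  have h2 := (q_pos z).ne'
  have h3 : q z⁻¹ = q z / ‖z‖ ^ 2 := by
    unfold q; rw [norm_inv]; field_simp; ring
  ext i
  fin_cases i <;>
    simp [stereoVec, stereoInvVec, h3, Complex.inv_re, Complex.inv_im,
      Complex.normSq_eq_norm_sq] <;>
    field_simp

lemma exists_pullback_inv {h : Sphere2 → ℝ} (hh : ContMDiff (𝓡 2) 𝓘(ℝ, ℝ) ∞ h) :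
    ∃ F : ℂ → ℂ, ContDiff ℝ ∞ F ∧ ∀ z, z ≠ 0 → pullback h z = F z⁻¹ := by
  refine ⟨_, contDiff_comp_sphere hh (f := stereoInvVec) ?_ stereoInvVec_mem, fun z hz => ?_⟩
  · exact contDiff_euclid_three
      (contDiff_div_q (contDiff_const.mul Complex.reCLM.contDiff))
      (contDiff_div_q (contDiff_const.mul Complex.imCLM.contDiff))
      (contDiff_div_q ((contDiff_norm_sq ℝ).sub contDiff_const))
  · simp only [pullback, stereo, stereoVec_eq_stereoInvVec hz]

/-- Compactness of the unit disc bounds `g` on it, and bounds `g₁ z⁻¹` outside it. The factor `2 ^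
j` compares `1` and `‖z‖⁻²` with `2 / q` in the two regions. -/
lemma exists_decay_bound {g g₁ φ : ℂ → ℂ} (hg : Continuous g) (hg₁ : Continuous g₁) (j : ℕ)
    (hφ : ∀ z, z ≠ 0 → ‖φ z‖ = ((‖z‖ ^ 2)⁻¹) ^ j)
    (h : ∀ z, z ≠ 0 → g z = g₁ z⁻¹ * φ z) : ∃ C, ∀ z, ‖g z‖ ≤ C / q z ^ j := by
  obtain ⟨A, hA⟩ := (isCompact_closedBall (0 : ℂ) 1).exists_bound_of_continuousOn hg.continuousOn
  obtain ⟨B, hB⟩ := (isCompact_closedBall (0 : ℂ) 1).exists_bound_of_continuousOn hg₁.continuousOn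
  have hA0 : 0 ≤ A := (norm_nonneg _).trans (hA 0 (by simp))
  have hB0 : 0 ≤ B := (norm_nonneg _).trans (hB 0 (by simp))
  refine ⟨(A + B) * 2 ^ j, fun z => ?_⟩
  have hq := q_pos z
  rw [mul_div_assoc, ← div_pow]
  rcases le_total ‖z‖ 1 with hz | hz
  · have h1 : 1 ≤ 2 / q z := by
      rw [one_le_div hq, q]; nlinarith [norm_nonneg z]
    calc ‖g z‖ ≤ A := hA z (by simpa using hz)
      _ ≤ (A + B) * 1 := by linarith
      _ ≤ _ := by gcongr; exact one_le_pow₀ h1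
  · have hz0 : z ≠ 0 := by rintro rfl; simp at hz; linarith
    have h1 : (‖z‖ ^ 2)⁻¹ ≤ 2 / q z := by
      rw [inv_le_comm₀ (by positivity) (by positivity), inv_div, q]; nlinarith
    have h2 : ‖g₁ z⁻¹‖ ≤ B := hB _ (by simpa using inv_le_one_of_one_le₀ hz)
    rw [h z hz0, norm_mul, hφ z hz0]
    gcongr
    linarith

/-- Decay at infinity of a function on the plane that is smooth at infinity, and of its
derivatives. -/
theorem exists_wirtinger_decay {F F₁ : ℂ → ℂ} (hF : ContDiff ℝ ∞ F) (hF₁ : ContDiff ℝ ∞ F₁)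
    (h : ∀ z, z ≠ 0 → F z = F₁ z⁻¹) :
    ∃ C, ∀ z, ‖F z‖ ≤ C ∧ ‖dz F z‖ ≤ C / q z ∧ ‖dzbar F z‖ ≤ C / q z ∧
      ‖dz (dzbar F) z‖ ≤ C / q z ^ 2 := by
  have cd : ContDiff ℝ ∞ (dz F) := ContDiff.dz hF (by simp)
  have cd₁ : ContDiff ℝ ∞ (dz F₁) := ContDiff.dz hF₁ (by simp)
  have cb : ContDiff ℝ ∞ (dzbar F) := ContDiff.dzbar hF (by simp)
  have cb₁ : ContDiff ℝ ∞ (dzbar F₁) := ContDiff.dzbar hF₁ (by simp)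
  have cdb : ContDiff ℝ ∞ (dz (dzbar F)) := ContDiff.dz cb (by simp)
  have cdb₁ : ContDiff ℝ ∞ (dz (dzbar F₁)) := ContDiff.dz cb₁ (by simp)
  have hne : ∀ z : ℂ, z ≠ 0 → ∀ᶠ w in nhds z, w ≠ 0 := fun z hz => isOpen_ne.mem_nhds hz
  have hd : ∀ z, z ≠ 0 → HasWirt F (dz F₁ z⁻¹ * -(z ^ 2)⁻¹)
      (dzbar F₁ z⁻¹ * star (-(z ^ 2)⁻¹)) z := by
    intro z hz
    have h1 := HasWirt.comp_holo (φ := fun w : ℂ => w⁻¹)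
      (hasWirt ((hF₁.differentiable (by simp)) z⁻¹)) (hasDerivAt_inv hz)
    exact h1.congr_of_eventuallyEq ((hne z hz).mono fun w hw => h w hw)
  have hdb : ∀ z, z ≠ 0 → dz (dzbar F) z =
      dz (dzbar F₁) z⁻¹ * (-(z ^ 2)⁻¹ * star (-(z ^ 2)⁻¹)) := by
    intro z hz
    have h1 := HasWirt.comp_holo (φ := fun w : ℂ => w⁻¹)
      (hasWirt ((cb₁.differentiable (by simp)) z⁻¹)) (hasDerivAt_inv hz)
    have h2 : HasDerivAt (fun w : ℂ => -(w ^ 2)⁻¹) (deriv (fun w : ℂ => -(w ^ 2)⁻¹) z) z :=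
      (DifferentiableAt.fun_neg
        (((differentiableAt_id (x := z)).pow 2).fun_inv (pow_ne_zero 2 hz))).hasDerivAt
    -- The factor `star (-(z ^ 2)⁻¹)` is antiholomorphic, so `dz` kills it. Hence no first
    -- derivative of `F₁` enters `dz (dzbar F)`, and the full decay `‖z‖⁻⁴` survives.
    have h3 := HasWirt.comp_holo (hasWirt_star _) h2
    have h4 := (h1.mul h3).congr_of_eventuallyEq
      ((hne z hz).mono fun w hw => (hd w hw).dzbar_eq)
    rw [h4.dz_eq]; ring
  obtain ⟨C0, h0⟩ := exists_decay_bound hF.continuous hF₁.continuous 0 (φ := fun _ : ℂ => 1)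
    (by simp) (by simpa using h)
  obtain ⟨C1, h1⟩ := exists_decay_bound cd.continuous cd₁.continuous 1
    (φ := fun z => -(z ^ 2)⁻¹) (by simp) fun z hz => (hd z hz).dz_eq
  obtain ⟨C2, h2⟩ := exists_decay_bound cb.continuous cb₁.continuous 1
    (φ := fun z => star (-(z ^ 2)⁻¹)) (by simp) fun z hz => (hd z hz).dzbar_eq
  obtain ⟨C3, h3⟩ := exists_decay_bound cdb.continuous cdb₁.continuous 2
    (φ := fun z => -(z ^ 2)⁻¹ * star (-(z ^ 2)⁻¹)) (by intro z _; simp; ring) hdb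
  refine ⟨max (max C0 C1) (max C2 C3), fun z => ⟨?_, ?_, ?_, ?_⟩⟩
  · refine (h0 z).trans ?_
    simp
  · refine (h1 z).trans ?_
    rw [pow_one]
    have := q_pos z
    gcongr; simp
  · refine (h2 z).trans ?_
    rw [pow_one]
    have := q_pos z
    gcongr; simp
  · refine (h3 z).trans ?_
    have := q_pos z
    gcongr; simp

/-! ### Growth at infinity -/

/-- `f` grows at most like the `k`-th power of `√q`. -/
def Growth (f : ℂ → ℂ) (k : ℤ) : Prop := ∃ C, ∀ z, ‖f z‖ ≤ C * √(q z) ^ k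

lemma one_le_sqrt_q (z : ℂ) : 1 ≤ √(q z) := by
  rw [Real.one_le_sqrt, q]; nlinarith [norm_nonneg z]

lemma sqrt_q_pos (z : ℂ) : 0 < √(q z) := Real.sqrt_pos.2 (q_pos z)

lemma norm_le_sqrt_q (z : ℂ) : ‖z‖ ≤ √(q z) := by
  apply Real.le_sqrt_of_sq_le; rw [q]; linarith

lemma growth_nonneg_const {f : ℂ → ℂ} {k : ℤ} {C : ℝ} (h : ∀ z, ‖f z‖ ≤ C * √(q z) ^ k) :
    0 ≤ C :=
  nonneg_of_mul_nonneg_left ((norm_nonneg _).trans (h 0)) (zpow_pos (sqrt_q_pos 0) k)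

lemma Growth.mul {f g : ℂ → ℂ} {j k : ℤ} (hf : Growth f j) (hg : Growth g k) :
    Growth (fun z => f z * g z) (j + k) := by
  obtain ⟨C, hC⟩ := hf
  obtain ⟨D, hD⟩ := hg
  refine ⟨C * D, fun z => ?_⟩
  rw [norm_mul, zpow_add₀ (sqrt_q_pos z).ne']
  calc _ ≤ (C * √(q z) ^ j) * (D * √(q z) ^ k) :=
        mul_le_mul (hC z) (hD z) (norm_nonneg _) ((norm_nonneg _).trans (hC z))
    _ = _ := by ring

lemma Growth.add {f g : ℂ → ℂ} {k : ℤ} (hf : Growth f k) (hg : Growth g k) :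
    Growth (fun z => f z + g z) k := by
  obtain ⟨C, hC⟩ := hf
  obtain ⟨D, hD⟩ := hg
  refine ⟨C + D, fun z => (norm_add_le _ _).trans ?_⟩
  rw [add_mul]
  exact add_le_add (hC z) (hD z)

lemma Growth.neg {f : ℂ → ℂ} {k : ℤ} (hf : Growth f k) : Growth (fun z => -f z) k := by
  simpa [Growth] using hf

lemma Growth.sub {f g : ℂ → ℂ} {k : ℤ} (hf : Growth f k) (hg : Growth g k) :
    Growth (fun z => f z - g z) k := by
  simpa [sub_eq_add_neg] using hf.add hg.neg

lemma Growth.of_le {f : ℂ → ℂ} {j k : ℤ} (hf : Growth f j) (h : j ≤ k) : Growth f k := by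
  obtain ⟨C, hC⟩ := hf
  have := growth_nonneg_const hC
  exact ⟨C, fun z => (hC z).trans (by gcongr; exact one_le_sqrt_q z)⟩

lemma growth_const (c : ℂ) : Growth (fun _ => c) 0 := ⟨‖c‖, fun z => by simp⟩

lemma growth_id : Growth (fun z => z) 1 := ⟨1, fun z => by simpa using norm_le_sqrt_q z⟩

lemma growth_star : Growth (fun z => star z) 1 := ⟨1, fun z => by simpa using norm_le_sqrt_q z⟩

lemma Growth.const_mul {f : ℂ → ℂ} {k : ℤ} (c : ℂ) (hf : Growth f k) :
    Growth (fun z => c * f z) k := by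
  simpa using (growth_const c).mul hf

lemma Growth.pow {f : ℂ → ℂ} {k : ℤ} (hf : Growth f k) (n : ℕ) :
    Growth (fun z => f z ^ n) (n * k) := by
  induction n with
  | zero => simpa using growth_const 1
  | succ n ih =>
    have := ih.mul hf
    simp only [pow_succ]
    convert this using 1
    push_cast; ring

/-- In powers of `√q`, which is comparable to `1 + ‖z‖`, order `-3` is the first integer order that
is integrable on the plane. -/
lemma Growth.integrable {f : ℂ → ℂ} (hf : Growth f (-3)) (hc : Continuous f) : Integrable f := by
  obtain ⟨C, hC⟩ := hf
  refine (integrable_inv_q_mul_sqrt.const_mul C).mono' hc.aestronglyMeasurable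
    (Filter.Eventually.of_forall fun z => (hC z).trans (le_of_eq ?_))
  have h1 := Real.sq_sqrt (q_pos z).le
  rw [zpow_neg]
  congr 2
  conv_rhs => rw [← h1]
  rw [h1]
  norm_cast
  rw [pow_succ, h1]

/-! ### The integral identity -/

/-- The function `q⁻ⁿ (1 + z̄ t)ᵃ (t - z)ᵇ`. -/
def qmono (t : ℂ) (n a b : ℕ) (z : ℂ) : ℂ :=
  ((q z : ℂ)⁻¹) ^ n * (1 + star z * t) ^ a * (t - z) ^ b

lemma q_cast (z : ℂ) : (q z : ℂ) = 1 + z * star z := by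
  rw [q, Complex.star_def, Complex.mul_conj, Complex.normSq_eq_norm_sq]; push_cast; rfl

lemma q_cast_ne (z : ℂ) : (q z : ℂ) ≠ 0 := Complex.ofReal_ne_zero.2 (q_pos z).ne'

lemma hasWirt_q (z : ℂ) : HasWirt (fun w => (q w : ℂ)) (star z) z z := by
  simp_rw [q_cast]
  convert! (hasWirt_const 1 z).add ((hasWirt_id z).mul (hasWirt_star z)) using 1 <;> ring

/-- The truncated exponents `a - 1` and `b - 1` do no harm: they come with the factors `a` and `b`.
-/
lemma hasWirt_qmono (t : ℂ) (n a b : ℕ) (z : ℂ) :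
    HasWirt (qmono t n a b)
      (-(n * star z * qmono t (n + 1) a b z) - b * qmono t n a (b - 1) z)
      (-(n * z * qmono t (n + 1) a b z) + a * t * qmono t n (a - 1) b z) z := by
  have h1 := ((hasWirt_q z).inv (q_cast_ne z)).pow n
  have h2 := ((hasWirt_const 1 z).add ((hasWirt_star z).mul (hasWirt_const t z))).pow a
  have h3 := ((hasWirt_const t z).sub (hasWirt_id z)).pow b
  have hn : (n : ℂ) * ((q z : ℂ)⁻¹) ^ (n - 1) * ((q z : ℂ) ^ 2)⁻¹ =
      n * ((q z : ℂ)⁻¹) ^ (n + 1) := by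
    rcases n with _ | n
    · simp
    · rw [Nat.add_sub_cancel, ← inv_pow]; ring
  convert! (h1.mul h2).mul h3 using 1
  · simp only [qmono]
    linear_combination (star z * (1 + star z * t) ^ a * (t - z) ^ b) * hn
  · simp only [qmono]
    linear_combination (z * (1 + star z * t) ^ a * (t - z) ^ b) * hn

lemma contDiff_star : ContDiff ℝ ∞ fun z : ℂ => star z := Complex.conjCLE.contDiff

lemma contDiff_qmono (t : ℂ) (n a b : ℕ) : ContDiff ℝ ∞ (qmono t n a b) := by
  have h1 : ContDiff ℝ ∞ fun z => (q z : ℂ)⁻¹ :=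
    (Complex.ofRealCLM.contDiff.comp contDiff_q).inv q_cast_ne
  exact ((h1.pow n).mul ((contDiff_const.add (contDiff_star.mul contDiff_const)).pow a)).mul
    ((contDiff_const.sub contDiff_id).pow b)

lemma growth_q_inv : Growth (fun z => (q z : ℂ)⁻¹) (-2) := by
  refine ⟨1, fun z => le_of_eq ?_⟩
  rw [norm_inv, Complex.norm_real, Real.norm_of_nonneg (q_pos z).le, zpow_neg, one_mul]
  norm_cast
  rw [Real.sq_sqrt (q_pos z).le]

lemma growth_qmono (t : ℂ) (n a b : ℕ) {k : ℤ} (hk : (a : ℤ) + b - 2 * n ≤ k) :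
    Growth (qmono t n a b) k := by
  have h1 : Growth (fun z => 1 + star z * t) 1 :=
    ((growth_const 1).of_le zero_le_one).add (by simpa using growth_star.mul (growth_const t))
  have h2 : Growth (fun z => t - z) 1 := ((growth_const t).of_le zero_le_one).sub growth_id
  exact (((growth_q_inv.pow n).mul (h1.pow a)).mul (h2.pow b)).of_le (by linarith)

/-- The hypotheses on functions on the plane that come from smooth functions on the sphere. -/
structure SphereSmooth (F : ℂ → ℂ) : Prop where
  contDiff : ContDiff ℝ ∞ F
  growth : Growth F 0
  growth_dz : Growth (dz F) (-2)
  growth_dzbar : Growth (dzbar F) (-2)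
  growth_dz_dzbar : Growth (dz (dzbar F)) (-4)

lemma sphereSmooth_pullback {h : Sphere2 → ℝ} (hh : ContMDiff (𝓡 2) 𝓘(ℝ, ℝ) ∞ h) :
    SphereSmooth (pullback h) := by
  obtain ⟨F₁, h1, h2⟩ := exists_pullback_inv hh
  obtain ⟨C, hC⟩ := exists_wirtinger_decay (contDiff_pullback hh) h1 h2
  have h4 : ∀ z, √(q z) ^ (-2 : ℤ) = (q z)⁻¹ := fun z => by
    rw [zpow_neg]; norm_cast; rw [Real.sq_sqrt (q_pos z).le]
  have h5 : ∀ z, √(q z) ^ (-4 : ℤ) = (q z ^ 2)⁻¹ := fun z => by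
    rw [show (-4 : ℤ) = -2 + -2 by norm_num, zpow_add₀ (sqrt_q_pos z).ne', h4, sq, mul_inv]
  refine ⟨contDiff_pullback hh, ⟨C, fun z => ?_⟩, ⟨C, fun z => ?_⟩, ⟨C, fun z => ?_⟩,
    ⟨C, fun z => ?_⟩⟩
  · simpa using (hC z).1
  · rw [h4]; exact (hC z).2.1
  · rw [h4]; exact (hC z).2.2.1
  · rw [h5]; exact (hC z).2.2.2

/-- The integrand that comes from the positive half of the spinor bundle. -/
def posInt (c₀ c₁ t : ℂ) (L : ℕ) (F : ℂ → ℂ) (z : ℂ) : ℂ :=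
  2 * (c₁ - c₀ * z) * qmono t (L + 2) L (L + 1) z * dz F z -
    (c₀ + c₁ * star z) * qmono t (L + 1) L (L + 1) z * dz (dzbar F) z

/-- The integrand that comes from the negative half of the spinor bundle. -/
def negInt (c₀ c₁ t : ℂ) (L : ℕ) (F : ℂ → ℂ) (z : ℂ) : ℂ :=
  -(2 * (c₀ + c₁ * star z) * qmono t (L + 2) (L + 1) L z * dzbar F z) +
    (c₀ * z - c₁) * qmono t (L + 1) (L + 1) L z * dz (dzbar F) z

/-- The integrand of the scalar product with a spherical harmonic. -/
def scalInt (c₀ c₁ t : ℂ) (L : ℕ) (F : ℂ → ℂ) (z : ℂ) : ℂ :=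
  (c₀ * t - c₁) * qmono t (L + 2) L L z * F z

lemma growth_affine (c d : ℂ) : Growth (fun z => c + d * z) 1 :=
  ((growth_const c).of_le zero_le_one).add (growth_id.const_mul d)

lemma growth_affine_star (c d : ℂ) : Growth (fun z => c + d * star z) 1 :=
  ((growth_const c).of_le zero_le_one).add (growth_star.const_mul d)

lemma SphereSmooth.contDiff_dz {F : ℂ → ℂ} (hF : SphereSmooth F) : ContDiff ℝ ∞ (dz F) :=
  ContDiff.dz hF.contDiff (by simp)

lemma SphereSmooth.contDiff_dzbar {F : ℂ → ℂ} (hF : SphereSmooth F) :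
    ContDiff ℝ ∞ (dzbar F) :=
  ContDiff.dzbar hF.contDiff (by simp)

lemma SphereSmooth.contDiff_dz_dzbar {F : ℂ → ℂ} (hF : SphereSmooth F) :
    ContDiff ℝ ∞ (dz (dzbar F)) :=
  ContDiff.dz hF.contDiff_dzbar (by simp)

lemma integrable_posInt {F : ℂ → ℂ} (hF : SphereSmooth F) (c₀ c₁ t : ℂ) (L : ℕ) :
    Integrable (posInt c₀ c₁ t L F) := by
  apply Growth.integrable
  · have h1 : Growth (fun z => 2 * (c₁ - c₀ * z)) 1 := by
      simpa [sub_eq_add_neg] using (growth_affine c₁ (-c₀)).const_mul 2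
    have h2 := (h1.mul (growth_qmono t (L + 2) L (L + 1) (k := -3) (by push_cast; linarith))).mul
      hF.growth_dz
    have h3 := ((growth_affine_star c₀ c₁).mul
      (growth_qmono t (L + 1) L (L + 1) (k := -1) (by push_cast; linarith))).mul hF.growth_dz_dzbar
    exact (h2.of_le (by norm_num)).sub (h3.of_le (by norm_num))
  · have := (contDiff_qmono t (L + 2) L (L + 1)).continuous
    have := (contDiff_qmono t (L + 1) L (L + 1)).continuous
    have := hF.contDiff_dz.continuous
    have := hF.contDiff_dz_dzbar.continuous
    unfold posInt
    fun_prop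

lemma integrable_negInt {F : ℂ → ℂ} (hF : SphereSmooth F) (c₀ c₁ t : ℂ) (L : ℕ) :
    Integrable (negInt c₀ c₁ t L F) := by
  apply Growth.integrable
  · have h1 : Growth (fun z => c₀ * z - c₁) 1 := by
      simpa [sub_eq_add_neg, add_comm] using (growth_affine (-c₁) c₀)
    have h2 := (((growth_affine_star c₀ c₁).const_mul 2).mul
      (growth_qmono t (L + 2) (L + 1) L (k := -3) (by push_cast; linarith))).mul
      hF.growth_dzbar
    have h3 := (h1.mul
      (growth_qmono t (L + 1) (L + 1) L (k := -1) (by push_cast; linarith))).mul hF.growth_dz_dzbar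
    exact (h2.neg.of_le (by norm_num)).add (h3.of_le (by norm_num))
  · have := (contDiff_qmono t (L + 2) (L + 1) L).continuous
    have := (contDiff_qmono t (L + 1) (L + 1) L).continuous
    have := hF.contDiff_dzbar.continuous
    have := hF.contDiff_dz_dzbar.continuous
    unfold negInt
    fun_prop

lemma integrable_scalInt {F : ℂ → ℂ} (hF : SphereSmooth F) (c₀ c₁ t : ℂ) (L : ℕ) :
    Integrable (scalInt c₀ c₁ t L F) := by
  apply Growth.integrable
  · have h2 := ((growth_qmono t (L + 2) L L (k := -4) (by push_cast; linarith)).const_mul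
      (c₀ * t - c₁)).mul hF.growth
    exact h2.of_le (by norm_num)
  · have := (contDiff_qmono t (L + 2) L L).continuous
    have := hF.contDiff.continuous
    unfold scalInt
    fun_prop

/-- The integral identity behind the theorem: two integrations by parts, and the eigenvalue
equation of the spherical harmonics. -/
theorem integral_posInt_sub_negInt {F : ℂ → ℂ} (hF : SphereSmooth F) (c₀ c₁ t : ℂ) (L : ℕ) :
    (∫ z, posInt c₀ c₁ t L F z) - ∫ z, negInt c₀ c₁ t L F z =
      (L * (L - 1) : ℂ) * ∫ z, scalInt c₀ c₁ t L F z := by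
  -- The first terms of `G` and `H` integrate the first-order terms by parts. The second ones are
  -- Green's formula for `m = qmono t L L L`: since `dz m = -L * qmono t (L + 1) (L + 1) (L - 1)`,
  -- they are `-(c₀ t - c₁) m ∂̄F` and `(c₀ t - c₁) (∂m) F`, and the products `∂m ∂̄F` cancel in the
  -- divergence.
  set G : ℂ → ℂ := fun z => 2 * (c₁ - c₀ * z) * qmono t (L + 2) L (L + 1) z * F z -
    (c₀ * t - c₁) * qmono t L L L z * dzbar F z with hG
  set H : ℂ → ℂ := fun z => 2 * (c₀ + c₁ * star z) * qmono t (L + 2) (L + 1) L z * F z +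
    (-(L * (c₀ * t - c₁)) * qmono t (L + 1) (L + 1) (L - 1) z) * F z with hH
  have cG : ContDiff ℝ ∞ G :=
    (((contDiff_const.mul (contDiff_const.sub (contDiff_const.mul contDiff_id))).mul
      (contDiff_qmono t _ _ _)).mul hF.contDiff).sub
      ((contDiff_const.mul (contDiff_qmono t _ _ _)).mul hF.contDiff_dzbar)
  have cH : ContDiff ℝ ∞ H :=
    (((contDiff_const.mul (contDiff_const.add (contDiff_const.mul contDiff_star))).mul
      (contDiff_qmono t _ _ _)).mul hF.contDiff).add
      ((contDiff_const.mul (contDiff_qmono t _ _ _)).mul hF.contDiff)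
  have gG : Growth G (-2) := by
    have h1 : Growth (fun z => 2 * (c₁ - c₀ * z)) 1 := by
      simpa [sub_eq_add_neg] using (growth_affine c₁ (-c₀)).const_mul 2
    have h2 := (h1.mul (growth_qmono t (L + 2) L (L + 1) (k := -3) (by push_cast; linarith))).mul
      hF.growth
    have h3 := ((growth_qmono t L L L (k := 0) (by linarith)).const_mul
      (c₀ * t - c₁)).mul hF.growth_dzbar
    exact (h2.of_le (by norm_num)).sub (h3.of_le (by norm_num))
  have gH : Growth H (-2) := by
    have h2 := (((growth_affine_star c₀ c₁).const_mul 2).mul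
      (growth_qmono t (L + 2) (L + 1) L (k := -3) (by push_cast; linarith))).mul
      hF.growth
    have h3 : Growth (fun z => (-(L * (c₀ * t - c₁)) * qmono t (L + 1) (L + 1) (L - 1) z) * F z)
        (-2) := by
      -- For `L = 0` the exponent `L - 1` is truncated and the growth count fails, but the
      -- coefficient `L` vanishes.
      rcases L with _ | L
      · exact ⟨0, fun z => by simp⟩
      · exact (((growth_qmono t (L + 1 + 1) (L + 1 + 1) (L + 1 - 1) (k := -2)
          (by simp; linarith)).const_mul _).mul hF.growth).of_le (by norm_num)
    exact (h2.of_le (by norm_num)).add h3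
  have hdiv : ∀ z, dz G z + dzbar H z =
      posInt c₀ c₁ t L F z - negInt c₀ c₁ t L F z
        - (L * (L - 1) : ℂ) * scalInt c₀ c₁ t L F z := by
    intro z
    have hF0 := hasWirt (g := F) (z := z) (hF.contDiff.differentiable (by simp) z)
    have hF1 := hasWirt (g := dzbar F) (z := z) (hF.contDiff_dzbar.differentiable (by simp) z)
    have k1 := ((((hasWirt_const 2 z).mul ((hasWirt_const c₁ z).sub
      ((hasWirt_const c₀ z).mul (hasWirt_id z)))).mul
      (hasWirt_qmono t (L + 2) L (L + 1) z)).mul hF0).sub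
      (((hasWirt_const (c₀ * t - c₁) z).mul (hasWirt_qmono t L L L z)).mul hF1)
    have k2 := ((((hasWirt_const 2 z).mul ((hasWirt_const c₀ z).add
      ((hasWirt_const c₁ z).mul (hasWirt_star z)))).mul
      (hasWirt_qmono t (L + 2) (L + 1) L z)).mul hF0).add
      (((hasWirt_const (-(L * (c₀ * t - c₁))) z).mul
        (hasWirt_qmono t (L + 1) (L + 1) (L - 1) z)).mul hF0)
    rw [k1.dz_eq, k2.dzbar_eq]
    have hq := q_cast z
    have hq0 := q_cast_ne z
    simp only [posInt, negInt, scalInt, qmono]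
    -- With `p = q⁻¹` and `s = z̄` as independent variables, this is the only relation needed; the
    -- rest is a polynomial identity.
    have hp : (q z : ℂ)⁻¹ * (1 + z * star z) = 1 := by rw [← hq]; exact inv_mul_cancel₀ hq0
    generalize (q z : ℂ)⁻¹ = p at hp ⊢
    generalize star z = s at hp ⊢
    rcases L with _ | L
    · push_cast
      linear_combination (F z * (-4 * p ^ 2 * (c₁ * s * t + c₀ * z))
        + (c₀ * t - c₁) * dz (dzbar F) z) * hp
    · simp only [Nat.add_sub_cancel]
      push_cast
      linear_combination (F z * (-2 * (L + 3) * p ^ (L + 3) * (1 + s * t) ^ (L + 1)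
        * (t - z) ^ (L + 1) * (c₁ * s * t + c₀ * z) + (L + 1) * (L + 2) * (c₀ * t - c₁) * t
        * p ^ (L + 2) * (1 + s * t) ^ (L + 1) * (t - z) ^ L) - dzbar F z * (c₀ * t - c₁) * (L + 1)
        * p ^ (L + 1) * (1 + s * t) ^ (L + 1) * (t - z) ^ L
        + (c₀ * t - c₁) * p ^ (L + 1) * (1 + s * t) ^ (L + 1) * (t - z) ^ (L + 1)
        * dz (dzbar F) z) * hp
  have hint : Integrable fun z => dz G z + dzbar H z := by
    simp_rw [hdiv]
    exact ((integrable_posInt hF c₀ c₁ t L).sub (integrable_negInt hF c₀ c₁ t L)).sub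
      ((integrable_scalInt hF c₀ c₁ t L).const_mul _)
  have hb : ∀ {f : ℂ → ℂ}, Growth f (-2) → ∃ C, ∀ z, ‖f z‖ ≤ C / q z := by
    rintro f ⟨C, hC⟩
    refine ⟨C, fun z => (hC z).trans (le_of_eq ?_)⟩
    rw [zpow_neg, div_eq_mul_inv]; norm_cast; rw [Real.sq_sqrt (q_pos z).le]
  obtain ⟨C, hC⟩ := hb gG
  obtain ⟨D, hD⟩ := hb gH
  have key := integral_wirtinger_div_eq_zero (C := max C D) (cG.of_le (by simp))
    (cH.of_le (by simp))
    (fun z => (hC z).trans (by have := q_pos z; gcongr; simp))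
    (fun z => (hD z).trans (by have := q_pos z; gcongr; simp)) hint
  have ip := integrable_posInt hF c₀ c₁ t L
  have im := integrable_negInt hF c₀ c₁ t L
  have is := (integrable_scalInt hF c₀ c₁ t L).const_mul (L * (L - 1) : ℂ)
  have e := integral_sub (ip.sub im) is
  simp only [Pi.sub_apply] at e
  simp_rw [hdiv] at key
  rw [key, integral_sub ip im, integral_const_mul] at e
  exact (sub_eq_zero.1 e.symm)

/-! ### The Kosmann-Lichnerowicz derivative in closed form -/

lemma hasFDerivAt_q (z : ℂ) :
    HasFDerivAt q ((2 * z.re) • Complex.reCLM + (2 * z.im) • Complex.imCLM) z := by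
  have : q = fun z : ℂ => 1 + (z.re ^ 2 + z.im ^ 2) := funext q_eq
  rw [this]
  convert! (hasFDerivAt_const (1 : ℝ) z).add
    ((Complex.reCLM.hasFDerivAt.pow 2).add (Complex.imCLM.hasFDerivAt.pow 2)) using 1
  ext u; simp

lemma metricCoeff_eq (i j : Fin 2) (z : ℂ) :
    metricCoeff i j z = if i = j then 4 / q z ^ 2 else 0 := by
  fin_cases i <;> fin_cases j <;> simp [metricCoeff, metric, coordVec]

lemma metricInv_eq (z : ℂ) : metricInv z = (q z ^ 2 / 4) • (1 : Matrix (Fin 2) (Fin 2) ℝ) := by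
  have hq := (q_pos z).ne'
  apply Matrix.inv_eq_left_inv
  ext i j
  fin_cases i <;> fin_cases j <;> simp [metricCoeff_eq] <;> field_simp

lemma partialDeriv_metricCoeff (l i j : Fin 2) (z : ℂ) :
    partialDeriv l (metricCoeff i j) z = if i = j then -16 / q z ^ 3 * comp l z else 0 := by
  have hq := (q_pos z).ne'
  have h0 : metricCoeff i j = fun w => if i = j then 4 / q w ^ 2 else 0 :=
    funext (metricCoeff_eq i j)
  rw [partialDeriv, h0]
  by_cases hij : i = j
  · simp only [hij, if_true]
    have h1 : HasFDerivAt (fun w => 4 / q w ^ 2) _ z :=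
      (hasDerivAt_inv (pow_ne_zero 2 hq)).const_mul 4 |>.comp_hasFDerivAt z
        ((hasFDerivAt_q z).pow 2)
    rw [h1.fderiv]
    fin_cases l <;> simp [comp, coordVec] <;> field_simp <;> ring
  · simp [hij]

/-- The Christoffel symbols of a conformal metric act by complex multiplication. -/
lemma leviCivita_eq (z u : ℂ) (Y : ℂ → ℂ) :
    leviCivita z u Y = fderiv ℝ Y z u - 2 * star z / q z * (u * Y z) := by
  have hq := (q_pos z).ne'
  have hqc := q_cast_ne z
  rw [leviCivita, sub_eq_add_neg]
  congr 1
  simp only [christoffel, metricInv_eq, partialDeriv_metricCoeff, Fin.sum_univ_two]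
  have e : (-(2 * star z / q z * (u * Y z)) : ℂ) =
      (((-2 / q z) • (star z * (u * Y z)) : ℂ)) := by
    rw [Complex.real_smul]; push_cast; ring
  rw [e]
  apply Complex.ext <;>
    simp [coordVec, comp, -Complex.ofReal_sum, -Complex.ofReal_add, -Complex.ofReal_mul] <;>
    field_simp <;> ring

lemma fderiv_frame (i : Fin 2) (z u : ℂ) :
    fderiv ℝ (frame i) z u = (((star z * u).re : ℝ) : ℂ) * coordVec i := by
  have h1 : HasFDerivAt (frame i) _ z :=
    (Complex.ofRealCLM.hasFDerivAt.comp z ((hasFDerivAt_q z).mul_const (2 : ℝ)⁻¹)).mul_const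
      (coordVec i)
  rw [h1.fderiv]
  simp
  ring

/-- The real part of `z̄ u` from differentiating `q / 2` cancels against the Christoffel term. Only
an infinitesimal rotation remains, as it must for an orthonormal frame. -/
lemma leviCivita_frame (i : Fin 2) (z u : ℂ) :
    leviCivita z u (frame i) = -(Complex.I * ((star z * u).im : ℝ)) * coordVec i := by
  have hqc := q_cast_ne z
  rw [leviCivita_eq, fderiv_frame, frame]
  have := Complex.re_add_im (star z * u)
  push_cast
  field_simp
  linear_combination (coordVec i) * this

lemma gamma_mul_gamma :
    gamma 0 * gamma 0 = -1 ∧ gamma 1 * gamma 1 = -1 ∧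
      gamma 0 * gamma 1 = !![-Complex.I, 0; 0, Complex.I] ∧
      gamma 1 * gamma 0 = !![Complex.I, 0; 0, -Complex.I] := by
  refine ⟨?_, ?_, ?_, ?_⟩ <;> ext i j <;> fin_cases i <;> fin_cases j <;>
    simp [gamma, Matrix.mul_apply, Fin.sum_univ_two]

/-- The zeroth order coefficient of the Kosmann-Lichnerowicz derivative. -/
def kosmannCoeff (X : ℂ → ℂ) (z : ℂ) : ℝ := -(dz X z).im / 2

/-- The spin connection and the antisymmetrized `∇X` each contain a multiple of `Im (z̄ X) / q`, and
these cancel. What is left is half the rotation part of the flat derivative of `X`. -/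
lemma kosmannDeriv_eq (X : ℂ → ℂ) (ψ : Spinor) (z : ℂ) :
    kosmannDeriv X ψ z = fderiv ℝ ψ z (X z) +
      ![-Complex.I * kosmannCoeff X z * ψ z 0, Complex.I * kosmannCoeff X z * ψ z 1] := by
  have hq := (q_pos z).ne'
  have hqc := q_cast_ne z
  obtain ⟨g00, g11, g01, g10⟩ := gamma_mul_gamma
  have w : ∀ i j, metric z (leviCivita z (X z) (frame i)) (frame j z) =
      2 / q z * (star z * X z).im * ((coordVec i).im * (coordVec j).re -
        (coordVec i).re * (coordVec j).im) := by
    intro i j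
    rw [leviCivita_frame, metric, frame]
    simp
    field_simp
    ring
  have c01 : metric z (leviCivita z (frame 0 z) X) (frame 1 z)
      - metric z (leviCivita z (frame 1 z) X) (frame 0 z) =
      2 * (dz X z).im - 4 / q z * (star z * X z).im := by
    have h0 : frame 0 z = (q z / 2) • (1 : ℂ) := by simp [frame, coordVec]
    have h1 : frame 1 z = (q z / 2) • Complex.I := by simp [frame, coordVec]
    rw [leviCivita_eq, leviCivita_eq, h0, h1, map_smul, map_smul, dz]
    have e : ∀ v : ℂ, 2 * star z / (q z : ℂ) * (v * X z) = (2 / q z) • (star z * (v * X z)) := by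
      intro v; rw [Complex.real_smul]; push_cast; ring
    rw [e, e]
    simp [metric]
    field_simp
    ring
  have c10 := congrArg Neg.neg c01
  rw [neg_sub] at c10
  simp only [kosmannDeriv, spinDeriv, Fin.sum_univ_two, w, c01, c10, sub_self, g00, g11, g01, g10,
    kosmannCoeff]
  rw [add_sub_assoc]
  congr 1
  ext i
  fin_cases i <;>
    simp [coordVec, dotProduct, Fin.sum_univ_two] <;> field_simp <;> ring

/-! ### Hamiltonian fields -/

lemma fderiv_pullback {h : Sphere2 → ℝ} (hd : Differentiable ℝ (pullback h)) (z u : ℂ) :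
    fderiv ℝ (pullback h) z u = ((fderiv ℝ (fun w => h (stereo w)) z u : ℝ) : ℂ) := by
  have h1 : DifferentiableAt ℝ (fun w => h (stereo w)) z := by
    have := Complex.reCLM.differentiableAt.comp z (hd z)
    exact this
  have h2 : HasFDerivAt (pullback h) _ z := Complex.ofRealCLM.hasFDerivAt.comp z h1.hasFDerivAt
  rw [h2.fderiv]
  rfl

lemma star_dzbar_pullback {h : Sphere2 → ℝ} (hd : Differentiable ℝ (pullback h)) (z : ℂ) :
    star (dzbar (pullback h) z) = dz (pullback h) z := by
  simp [dz, dzbar, fderiv_pullback hd]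
  ring

/-- For a real function `2 ∂̄F` is the Euclidean gradient, and `dh = vol (X, ·)` says that it equals
`(4 / q²) i X`. -/
lemma IsHamiltonianField.eq {h : Sphere2 → ℝ} (hd : Differentiable ℝ (pullback h)) {X : ℂ → ℂ}
    (hX : IsHamiltonianField h X) (z : ℂ) :
    X z = -Complex.I / 2 * (q z : ℂ) ^ 2 * dzbar (pullback h) z := by
  have hq := (q_pos z).ne'
  have hqc := q_cast_ne z
  rw [dzbar, fderiv_pullback hd, fderiv_pullback hd, hX, hX]
  simp [areaForm, metric, cplxStr]
  field_simp
  conv_lhs => rw [← Complex.re_add_im (X z)]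
  linear_combination (4 * (X z).re : ℂ) * Complex.I_sq

lemma HasWirt.star {f : ℂ → ℂ} {a b z : ℂ} (h : HasWirt f a b z) :
    HasWirt (fun w => star (f w)) (star b) (star a) z := by
  unfold HasWirt at *
  convert! (Complex.conjCLE : ℂ →L[ℝ] ℂ).hasFDerivAt.comp z h using 1
  ext u; simp [wirt_apply]; ring

lemma dzbar_dz_eq_dz_dzbar {F : ℂ → ℂ} (hF : ContDiff ℝ ∞ F) (z : ℂ) :
    dzbar (dz F) z = dz (dzbar F) z := by
  have hs : IsSymmSndFDerivAt ℝ F z := hF.contDiffAt.isSymmSndFDerivAt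
    (by simpa using WithTop.coe_le_coe.2 (le_top : (2 : ℕ∞) ≤ ⊤))
  have hd : DifferentiableAt ℝ (fderiv ℝ F) z :=
    (hF.fderiv_right (m := ∞) (by simp)).differentiable (by simp) z
  have h1 : ∀ v, HasFDerivAt (fun w => fderiv ℝ F w v)
      ((fderiv ℝ (fderiv ℝ F) z).flip v) z := by
    intro v
    convert! (hd.hasFDerivAt.clm_apply (hasFDerivAt_const v z)) using 1
    ext u; simp
  have h2 : HasFDerivAt (dz F) _ z :=
    ((h1 1).fun_sub ((h1 Complex.I).const_mul Complex.I)).mul_const (2 : ℂ)⁻¹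
  have h3 : HasFDerivAt (dzbar F) _ z :=
    ((h1 1).fun_add ((h1 Complex.I).const_mul Complex.I)).mul_const (2 : ℂ)⁻¹
  rw [dzbar, dz, h2.fderiv, h3.fderiv]
  have := hs.eq 1 Complex.I
  simp [this]
  ring

/-- Conjugation turns `∂∂̄F` into `∂̄∂F`, and second derivatives commute. -/
lemma star_dz_dzbar_pullback {h : Sphere2 → ℝ} (hF : ContDiff ℝ ∞ (pullback h)) (z : ℂ) :
    star (dz (dzbar (pullback h)) z) = dz (dzbar (pullback h)) z := by
  have hd := hF.differentiable (by simp)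
  have h1 := (hasWirt ((ContDiff.dzbar (m := ∞) hF (by simp)).differentiable (by simp) z)).star
  simp_rw [star_dzbar_pullback hd] at h1
  rw [← h1.dzbar_eq, dzbar_dz_eq_dz_dzbar hF]

lemma IsHamiltonianField.kosmannCoeff_eq {h : Sphere2 → ℝ} (hF : ContDiff ℝ ∞ (pullback h))
    {X : ℂ → ℂ} (hX : IsHamiltonianField h X) (z : ℂ) :
    (kosmannCoeff X z : ℂ) =
      q z / 4 * (z * dz (pullback h) z + star z * dzbar (pullback h) z) +
        (q z : ℂ) ^ 2 / 4 * dz (dzbar (pullback h)) z := by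
  have hd := hF.differentiable (by simp)
  have h1 := hasWirt ((ContDiff.dzbar (m := ∞) hF (by simp)).differentiable (by simp) z)
  have h2 := ((hasWirt_const (-Complex.I / 2) z).mul ((hasWirt_q z).pow 2)).mul h1
  have h3 : X = fun z => -Complex.I / 2 * (q z : ℂ) ^ 2 * dzbar (pullback h) z :=
    funext (hX.eq hd)
  have h4 := h2.dz_eq
  rw [← h3] at h4
  have h5 : ((dz X z).im : ℂ) = (dz X z - star (dz X z)) / (2 * Complex.I) := by
    have := Complex.sub_conj (dz X z)
    rw [Complex.star_def, this]; field_simp [Complex.I_ne_zero]; push_cast; ring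
  have h6 := star_dz_dzbar_pullback hF z
  have h7 := star_dzbar_pullback hd z
  rw [kosmannCoeff, Complex.ofReal_div, Complex.ofReal_neg, h5, h4]
  simp only [star_add, star_mul', star_div₀, star_neg, h6, h7, star_star, star_pow, star_natCast]
  have hI := Complex.I_ne_zero
  simp
  field_simp
  ring

/-! ### The Kosmann-Lichnerowicz derivative of the spinors with `l = 1/2` -/

lemma hasWirt_comp_q {g : ℝ → ℝ} {g' : ℝ} {z : ℂ} (hg : HasDerivAt g g' (q z)) :
    HasWirt (fun w => ((g (q w) : ℝ) : ℂ)) (g' * star z) (g' * z) z := by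
  unfold HasWirt
  convert! Complex.ofRealCLM.hasFDerivAt.comp z (hg.comp_hasFDerivAt z (hasFDerivAt_q z)) using 1
  ext u
  have h1 := Complex.add_conj (star z * u)
  simp [wirt_apply] at h1 ⊢
  linear_combination (g' : ℂ) * h1

lemma hasWirt_rpow_q (z : ℂ) :
    HasWirt (fun w => ((q w ^ (-(1 / 2) : ℝ) : ℝ) : ℂ))
      (-(star z) / (2 * q z) * (q z ^ (-(1 / 2) : ℝ) : ℝ))
      (-z / (2 * q z) * (q z ^ (-(1 / 2) : ℝ) : ℝ)) z := by
  have hq := q_pos z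
  have h1 := hasWirt_comp_q (Real.hasDerivAt_rpow_const (p := -(1 / 2)) (Or.inl hq.ne'))
  have h2 : (-(1 / 2) * q z ^ (-(1 / 2) - 1 : ℝ) : ℝ) = -1 / (2 * q z) * q z ^ (-(1 / 2) : ℝ) := by
    rw [Real.rpow_sub_one hq.ne']; field_simp
  rw [h2] at h1
  convert! h1 using 1 <;> push_cast <;> ring

lemma fderiv_spinor_apply {ψ : Spinor} {z : ℂ} {a b : Fin 2 → ℂ}
    (h : ∀ i, HasWirt (fun w => ψ w i) (a i) (b i) z) (u : ℂ) (i : Fin 2) :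
    fderiv ℝ ψ z u i = a i * u + b i * star u := by
  have h1 : HasFDerivAt ψ (ContinuousLinearMap.pi fun i => wirt (a i) (b i)) z :=
    hasFDerivAt_pi.2 fun i => h i
  rw [h1.fderiv, ContinuousLinearMap.pi_apply, wirt_apply]

/-- Apart from `q^(-1/2)` the component is antiholomorphic, so `∂̄F` enters the transport term only
through `∂ q^(-1/2)`; the zeroth order coefficient cancels exactly this. For the other chirality the
roles of `∂` and `∂̄` are exchanged. -/
lemma kosmannDeriv_pos {h : Sphere2 → ℝ} (hF : ContDiff ℝ ∞ (pullback h)) {X : ℂ → ℂ}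
    (hX : IsHamiltonianField h X) (k c₀ c₁ : ℂ) {ψ : Spinor}
    (hψ : ∀ z, ψ z = ![k * (c₀ + c₁ * star z) * (q z ^ (-(1 / 2) : ℝ) : ℝ), 0]) (z : ℂ) :
    kosmannDeriv X ψ z 0 = Complex.I / 4 * k * (q z : ℂ) ^ 2 * (q z ^ (-(1 / 2) : ℝ) : ℝ) *
      (2 * (c₁ - c₀ * z) * (q z : ℂ)⁻¹ * dz (pullback h) z -
        (c₀ + c₁ * star z) * dz (dzbar (pullback h)) z) := by
  have hd := hF.differentiable (by simp)
  have hqc := q_cast_ne z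
  have hq := q_cast z
  have h0 := ((hasWirt_const k z).mul ((hasWirt_const c₀ z).add
    ((hasWirt_const c₁ z).mul (hasWirt_star z)))).mul (hasWirt_rpow_q z)
  have h1 := fderiv_spinor_apply (ψ := ψ) (z := z) (a := ![_, 0]) (b := ![_, 0]) (fun i => by
    fin_cases i
    · simp only [hψ]; exact h0
    · simpa [hψ] using hasWirt_const 0 z) (X z) 0
  have hs : star (X z) = Complex.I / 2 * (q z : ℂ) ^ 2 * dz (pullback h) z := by
    rw [hX.eq hd, ← star_dzbar_pullback hd]; simp
  rw [kosmannDeriv_eq, Pi.add_apply, h1, hs, hX.eq hd, hX.kosmannCoeff_eq hF, hψ]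
  simp only [Matrix.cons_val_zero]
  generalize ((q z ^ (-(1 / 2) : ℝ) : ℝ) : ℂ) = r
  generalize dz (dzbar (pullback h)) z = D
  generalize dz (pullback h) z = A
  generalize dzbar (pullback h) z = B
  generalize star z = s at *
  generalize (q z : ℂ) = Q at *
  field_simp
  subst hq
  ring

lemma kosmannDeriv_neg {h : Sphere2 → ℝ} (hF : ContDiff ℝ ∞ (pullback h)) {X : ℂ → ℂ}
    (hX : IsHamiltonianField h X) (k c₀ c₁ : ℂ) {ψ : Spinor}
    (hψ : ∀ z, ψ z = ![0, k * (c₀ * z - c₁) * (q z ^ (-(1 / 2) : ℝ) : ℝ)]) (z : ℂ) :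
    kosmannDeriv X ψ z 1 = Complex.I / 4 * k * (q z : ℂ) ^ 2 * (q z ^ (-(1 / 2) : ℝ) : ℝ) *
      (-(2 * (c₀ + c₁ * star z) * (q z : ℂ)⁻¹ * dzbar (pullback h) z) +
        (c₀ * z - c₁) * dz (dzbar (pullback h)) z) := by
  have hd := hF.differentiable (by simp)
  have hqc := q_cast_ne z
  have hq := q_cast z
  have h0 := ((hasWirt_const k z).mul (((hasWirt_const c₀ z).mul (hasWirt_id z)).sub
    (hasWirt_const c₁ z))).mul (hasWirt_rpow_q z)
  have h1 := fderiv_spinor_apply (ψ := ψ) (z := z) (a := ![0, _]) (b := ![0, _]) (fun i => by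
    fin_cases i
    · simpa [hψ] using hasWirt_const 0 z
    · simp only [hψ]; exact h0) (X z) 1
  have hs : star (X z) = Complex.I / 2 * (q z : ℂ) ^ 2 * dz (pullback h) z := by
    rw [hX.eq hd, ← star_dzbar_pullback hd]; simp
  rw [kosmannDeriv_eq, Pi.add_apply, h1, hs, hX.eq hd, hX.kosmannCoeff_eq hF, hψ]
  simp only [Matrix.cons_val_one]
  generalize ((q z ^ (-(1 / 2) : ℝ) : ℝ) : ℂ) = r
  generalize dz (dzbar (pullback h)) z = D
  generalize dz (pullback h) z = A
  generalize dzbar (pullback h) z = B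
  generalize star z = s at *
  generalize (q z : ℂ) = Q at *
  simp
  field_simp
  subst hq
  ring

/-! ### Generating polynomials of the spin-weighted spherical harmonics -/

/-- The generating polynomial `(1 + z t)ᵃ (t - z̄)ᵇ` in the variable `t`. -/
def genPoly (z : ℂ) (a b : ℕ) : Polynomial ℂ :=
  (1 + Polynomial.C z * Polynomial.X) ^ a * (Polynomial.X - Polynomial.C (star z)) ^ b

/-- With `a = l - s`, `b = l + s`, `M = l + n`, the condition `r + b = k + M` is the condition `r -
k = n - s` of the harmonics, freed of subtraction. -/
lemma coeff_genPoly (z : ℂ) (a b M : ℕ) :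
    (genPoly z a b).coeff M = ∑ r ∈ Finset.range (a + 1), ∑ k ∈ Finset.range (b + 1),
      if r + b = k + M then ((a.choose r : ℂ) * (b.choose k : ℂ)) * z ^ r * (-star z) ^ k
      else 0 := by
  have h1 : (1 + Polynomial.C z * Polynomial.X) ^ a =
      ∑ r ∈ Finset.range (a + 1), Polynomial.monomial r ((a.choose r : ℂ) * z ^ r) := by
    rw [add_comm, add_pow]
    refine Finset.sum_congr rfl fun r _ => ?_
    rw [← Polynomial.C_mul_X_pow_eq_monomial, one_pow, mul_one, mul_pow, ← Polynomial.C_pow,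
      Polynomial.C_mul, Polynomial.C_eq_natCast]
    ring
  have h2 : (Polynomial.X - Polynomial.C (star z)) ^ b =
      ∑ k ∈ Finset.range (b + 1),
        Polynomial.monomial (b - k) ((b.choose k : ℂ) * (-star z) ^ k) := by
    rw [sub_eq_add_neg, add_comm, add_pow, ← Polynomial.C_neg]
    refine Finset.sum_congr rfl fun r _ => ?_
    rw [← Polynomial.C_mul_X_pow_eq_monomial, ← Polynomial.C_pow,
      Polynomial.C_mul, Polynomial.C_eq_natCast]
    ring
  rw [genPoly, h1, h2, Finset.sum_mul_sum, Polynomial.finsetSum_coeff]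
  refine Finset.sum_congr rfl fun r _ => ?_
  rw [Polynomial.finsetSum_coeff]
  refine Finset.sum_congr rfl fun k hk => ?_
  rw [Polynomial.monomial_mul_monomial, Polynomial.coeff_monomial]
  have hk' := Finset.mem_range.1 hk
  have : r + (b - k) = M ↔ r + b = k + M := by omega
  simp only [this]
  split_ifs
  · ring
  · rfl

lemma natDegree_genPoly_le (z : ℂ) (a b : ℕ) : (genPoly z a b).natDegree ≤ a + b := by
  unfold genPoly
  refine Polynomial.natDegree_mul_le.trans (add_le_add ?_ ?_)
  · refine (Polynomial.natDegree_pow_le_of_le (m := 1) a (by compute_degree)).trans (by simp)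
  · refine (Polynomial.natDegree_pow_le_of_le (m := 1) b (by compute_degree)).trans (by simp)

lemma star_eval_genPoly (z : ℂ) (a b i : ℕ) :
    star ((genPoly z a b).eval (i : ℂ)) = (1 + star z * i) ^ a * (i - z) ^ b := by
  simp [genPoly]

/-- Coefficients of polynomials of bounded degree are linear in the values at integers. -/
lemma exists_coeff_weights (d M : ℕ) : ∃ w : ℕ → ℂ, ∀ P : Polynomial ℂ, P.natDegree < d →
    star (P.coeff M) = ∑ i ∈ Finset.range d, w i * star (P.eval (i : ℂ)) := by
  refine ⟨fun i => star ((Lagrange.basis (Finset.range d) (fun i : ℕ => (i : ℂ)) i).coeff M),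
    fun P hP => ?_⟩
  have h1 := Lagrange.eq_interpolate (s := Finset.range d) (v := fun i : ℕ => (i : ℂ)) (f := P)
    (fun i _ j _ h => Nat.cast_injective h)
    (by
      rw [Finset.card_range]
      exact Polynomial.degree_le_natDegree.trans_lt (by exact_mod_cast hP))
  conv_lhs => rw [h1]
  rw [Lagrange.interpolate_apply, Polynomial.finsetSum_coeff, star_sum]
  refine Finset.sum_congr rfl fun i _ => ?_
  rw [Polynomial.coeff_C_mul, star_mul']
  ring

lemma spinHarmonic_eq {s l n : ℝ} {a b M M' : ℕ} (ha : l - s = a) (hb : l + s = b)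
    (hM : l + n = M) (hM' : l - n = M') (z : ℂ) :
    spinHarmonic s l n z = (((-1 : ℝ) ^ ⌊n⌋ * √((2 * l + 1) / (4 * Real.pi) *
      ((M.factorial * M'.factorial : ℝ) / (b.factorial * a.factorial : ℝ))) * q z ^ (-l) : ℝ) : ℂ)
      * (genPoly z a b).coeff M := by
  rw [spinHarmonic, ha, hb, hM, hM', coeff_genPoly]
  simp only [Nat.floor_natCast]
  congr 1
  refine Finset.sum_congr rfl fun r _ => Finset.sum_congr rfl fun k _ => ?_
  have : (r : ℝ) - k = n - s ↔ r + b = k + M := by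
    rw [← Nat.cast_inj (R := ℝ)]
    push_cast
    rw [← hb, ← hM]
    constructor <;> intro h <;> linarith
  simp only [this]

/-- The normalization of the spin-weighted spherical harmonics of spin weight `±1/2`, with
`l = L + 1/2` and `n = M - l`. -/
def harmNorm (L M : ℕ) : ℝ :=
  (-1 : ℝ) ^ ((M : ℤ) - L - 1) * √((2 * L + 2) / (4 * Real.pi) *
    ((M.factorial * (2 * L + 1 - M).factorial : ℝ) / ((L + 1).factorial * L.factorial : ℝ)))

lemma floor_half (L M : ℕ) : ⌊-((L : ℝ) + 1 / 2) + M⌋ = (M : ℤ) - L - 1 := by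
  rw [Int.floor_eq_iff]
  push_cast
  constructor <;> linarith

lemma spinHarmonic_half_eq {L M : ℕ} (hM : M ≤ 2 * L + 1) {l n : ℝ} (hl : l = L + 1 / 2)
    (hn : n = -l + M) (z : ℂ) :
    spinHarmonic (1 / 2) l n z =
      (harmNorm L M : ℂ) * (q z ^ (-l) : ℝ) * (genPoly z L (L + 1)).coeff M ∧
    spinHarmonic (-(1 / 2)) l n z =
      (harmNorm L M : ℂ) * (q z ^ (-l) : ℝ) * (genPoly z (L + 1) L).coeff M := by
  have h1 : l + n = M := by rw [hn]; ring
  have h2 : l - n = (2 * L + 1 - M : ℕ) := by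
    rw [Nat.cast_sub hM, hn, hl]; push_cast; ring
  have h3 : ⌊n⌋ = (M : ℤ) - L - 1 := by rw [hn, hl, floor_half]
  have h4 : 2 * l + 1 = 2 * L + 2 := by rw [hl]; ring
  constructor
  · rw [spinHarmonic_eq (a := L) (b := L + 1) (by rw [hl]; ring) (by rw [hl]; push_cast; ring)
      h1 h2, h3, h4, harmNorm]
    push_cast; ring
  · rw [spinHarmonic_eq (a := L + 1) (b := L) (by rw [hl]; push_cast; ring) (by rw [hl]; ring)
      h1 h2, h3, h4, harmNorm, mul_comm (L.factorial : ℝ)]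
    push_cast; ring

lemma rpow_neg_natCast (z : ℂ) (L : ℕ) : ((q z ^ (-(L : ℝ)) : ℝ) : ℂ) = ((q z : ℂ)⁻¹) ^ L := by
  rw [Real.rpow_neg (q_pos z).le, Real.rpow_natCast]
  push_cast; rw [inv_pow]

/-- The square root converts the scalar normalization into the spinor one, so that one constant
`harmNorm` serves both. At `M = 0`, where the harmonic is out of range, both sides vanish. -/
lemma sphHarmonic_sub_half {L M : ℕ} (hM : M ≤ 2 * L + 1) {l n : ℝ} (hl : l = L + 1 / 2)
    (hn : n = -l + M) (z : ℂ) :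
    ((√((l + n) / l) : ℝ) : ℂ) * sphHarmonic (l - 1 / 2) (n - 1 / 2) z =
      (harmNorm L M : ℂ) * ((q z : ℂ)⁻¹) ^ L * (Polynomial.X * genPoly z L L).coeff M := by
  have hl' : l - 1 / 2 = L := by rw [hl]; ring
  have h1 : l + n = M := by rw [hn]; ring
  rcases M with _ | M
  · simp [h1]
  have h2 : (L : ℝ) - (n - 1 / 2) = (2 * L + 1 - (M + 1) : ℕ) := by
    rw [Nat.cast_sub hM, hn, hl]; push_cast; ring
  have h3 : ⌊n - 1 / 2⌋ = ((M + 1 : ℕ) : ℤ) - L - 1 := by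
    rw [Int.floor_eq_iff, hn, hl]; push_cast; constructor <;> linarith
  have hsq : √((l + n) / l) * √((2 * L + 1) / (4 * Real.pi) *
      ((M.factorial * (2 * L + 1 - (M + 1)).factorial : ℝ) / (L.factorial * L.factorial : ℝ))) =
      √((2 * L + 2) / (4 * Real.pi) * (((M + 1).factorial * (2 * L + 1 - (M + 1)).factorial : ℝ) /
        ((L + 1).factorial * L.factorial : ℝ))) := by
    rw [← Real.sqrt_mul (by rw [h1, hl]; positivity), h1, hl, Nat.factorial_succ,
      Nat.factorial_succ]
    congr 1
    push_cast
    have : (2 * (L : ℝ) + 1) ≠ 0 := by positivity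
    have : ((L : ℝ) + 1) ≠ 0 := by positivity
    have := Real.pi_ne_zero
    field_simp
  rw [sphHarmonic, hl', spinHarmonic_eq (a := L) (b := L) (M := M) (by ring) (by ring)
    (by rw [hn, hl]; push_cast; ring) h2, h3, Polynomial.coeff_X_mul, harmNorm, ← hsq,
    ← rpow_neg_natCast]
  push_cast; ring

/-- The minus sign comes from `(-1)^⌊n⌋`, since `⌊n + 1/2⌋ = ⌊n⌋ + 1`. The out-of-range case is now
`M = 2 * L + 1`. -/
lemma sphHarmonic_add_half {L M : ℕ} (hM : M ≤ 2 * L + 1) {l n : ℝ} (hl : l = L + 1 / 2)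
    (hn : n = -l + M) (z : ℂ) :
    ((√((l - n) / l) : ℝ) : ℂ) * sphHarmonic (l - 1 / 2) (n + 1 / 2) z =
      (harmNorm L M : ℂ) * ((q z : ℂ)⁻¹) ^ L * (-(genPoly z L L)).coeff M := by
  have hl' : l - 1 / 2 = L := by rw [hl]; ring
  rcases hM.eq_or_lt with hM | hM
  · have h1 : l - n = 0 := by rw [hn, hl, hM]; push_cast; ring
    have h2 : (genPoly z L L).coeff M = 0 :=
      Polynomial.coeff_eq_zero_of_natDegree_lt ((natDegree_genPoly_le z L L).trans_lt (by omega))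
    simp [h1, h2]
  obtain ⟨K, hK⟩ : ∃ K, 2 * L = M + K := ⟨2 * L - M, by omega⟩
  have hKr : 2 * (L : ℝ) = M + K := by exact_mod_cast hK
  have e1 : 2 * L + 1 - M = K + 1 := by omega
  have h1 : l - n = K + 1 := by rw [hn, hl]; linarith
  have h3 : ⌊n + 1 / 2⌋ = ((M : ℤ) - L - 1) + 1 := by
    rw [Int.floor_eq_iff, hn, hl]; push_cast; constructor <;> linarith
  have hsq : √((l - n) / l) * √((2 * L + 1) / (4 * Real.pi) *
      ((M.factorial * K.factorial : ℝ) / (L.factorial * L.factorial : ℝ))) =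
      √((2 * L + 2) / (4 * Real.pi) * ((M.factorial * (K + 1).factorial : ℝ) /
        ((L + 1).factorial * L.factorial : ℝ))) := by
    rw [← Real.sqrt_mul (by rw [h1, hl]; positivity), h1, hl, Nat.factorial_succ,
      Nat.factorial_succ]
    congr 1
    push_cast
    have : (2 * (L : ℝ) + 1) ≠ 0 := by positivity
    have : ((L : ℝ) + 1) ≠ 0 := by positivity
    have := Real.pi_ne_zero
    field_simp
  rw [sphHarmonic, hl', spinHarmonic_eq (a := L) (b := L) (M := M) (M' := K) (by ring) (by ring)
    (by rw [hn, hl]; ring) (by rw [hn, hl]; linarith), h3, zpow_add₀ (by norm_num), zpow_one,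
    Polynomial.coeff_neg, harmNorm, e1, ← hsq, ← rpow_neg_natCast]
  push_cast; ring

/-- The coefficients `c₀`, `c₁` of the eigenspinor with `l = 1/2` and `n = ε/2`. -/
def IsHalfWeight (ε : ℝ) (c₀ c₁ : ℂ) : Prop :=
  (ε = 1 ∧ c₀ = 1 ∧ c₁ = 0) ∨ (ε = -1 ∧ c₀ = 0 ∧ c₁ = 1)

lemma spinHarmonic_half_half {ε : ℝ} {c₀ c₁ : ℂ} (hc : IsHalfWeight ε c₀ c₁) (z : ℂ) :
    spinHarmonic (1 / 2) (1 / 2) (ε / 2) z =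
      ((√(1 / (2 * Real.pi)) : ℝ) : ℂ) * (c₀ + c₁ * star z) * (q z ^ (-(1 / 2) : ℝ) : ℝ) ∧
    spinHarmonic (-(1 / 2)) (1 / 2) (ε / 2) z =
      ((√(1 / (2 * Real.pi)) : ℝ) : ℂ) * (c₀ * z - c₁) * (q z ^ (-(1 / 2) : ℝ) : ℝ) := by
  have e : (2 : ℝ) / (4 * Real.pi) = 1 / (2 * Real.pi) := by field_simp; norm_num
  rcases hc with ⟨rfl, rfl, rfl⟩ | ⟨rfl, rfl, rfl⟩
  · obtain ⟨h1, h2⟩ := spinHarmonic_half_eq (L := 0) (M := 1) (l := 1 / 2) (n := 1 / 2)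
      (by norm_num) (by norm_num) (by norm_num) z
    rw [h1, h2]
    simp [harmNorm, genPoly, e, -one_div, Polynomial.coeff_one]
    ring
  · obtain ⟨h1, h2⟩ := spinHarmonic_half_eq (L := 0) (M := 0) (l := 1 / 2) (n := -1 / 2)
      (by norm_num) (by norm_num) (by norm_num) z
    rw [h1, h2]
    simp [harmNorm, genPoly, e, -one_div]
    ring

/-- Spin-weighted spherical harmonics as linear combinations of powers of the generating
functions. -/
theorem exists_harmonic_weights {L M : ℕ} (hM : M ≤ 2 * L + 1) {l n : ℝ} (hl : l = L + 1 / 2)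
    (hn : n = -l + M) {ε : ℝ} {c₀ c₁ : ℂ} (hc : IsHalfWeight ε c₀ c₁) :
    ∃ w : ℕ → ℂ, ∀ z : ℂ,
      star (spinHarmonic (1 / 2) l n z) = (q z ^ (-l) : ℝ) *
        ∑ i ∈ Finset.range (2 * L + 2), w i * ((1 + star z * i) ^ L * (i - z) ^ (L + 1)) ∧
      star (spinHarmonic (-(1 / 2)) l n z) = (q z ^ (-l) : ℝ) *
        ∑ i ∈ Finset.range (2 * L + 2), w i * ((1 + star z * i) ^ (L + 1) * (i - z) ^ L) ∧
      ((√((l + ε * n) / l) : ℝ) : ℂ) * star (sphHarmonic (l - 1 / 2) (n - ε / 2) z) =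
        ((q z : ℂ)⁻¹) ^ L * ∑ i ∈ Finset.range (2 * L + 2),
          w i * ((c₀ * i - c₁) * ((1 + star z * i) ^ L * (i - z) ^ L)) := by
  -- All three polynomials have degree at most `2 * L + 1`, so the same `2 * L + 2` nodes and
  -- weights extract the coefficient from each. The nodes are real, so conjugation affects only `z`.
  obtain ⟨w, hw⟩ := exists_coeff_weights (2 * L + 2) M
  refine ⟨fun i => harmNorm L M * w i, fun z => ?_⟩
  obtain ⟨h1, h2⟩ := spinHarmonic_half_eq hM hl hn z
  have d1 := natDegree_genPoly_le z L (L + 1)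
  have d2 := natDegree_genPoly_le z (L + 1) L
  have d3 := natDegree_genPoly_le z L L
  have hr : ∀ x : ℝ, star (x : ℂ) = x := Complex.conj_ofReal
  refine ⟨?_, ?_, ?_⟩
  · rw [h1, star_mul', star_mul', hw _ (by omega), hr, hr]
    simp only [star_eval_genPoly, mul_assoc, ← Finset.mul_sum]
    ring
  · rw [h2, star_mul', star_mul', hw _ (by omega), hr, hr]
    simp only [star_eval_genPoly, mul_assoc, ← Finset.mul_sum]
    ring
  · have key : ((√((l + ε * n) / l) : ℝ) : ℂ) * sphHarmonic (l - 1 / 2) (n - ε / 2) z =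
        (harmNorm L M : ℂ) * ((q z : ℂ)⁻¹) ^ L *
          ((Polynomial.C c₀ * Polynomial.X - Polynomial.C c₁) * genPoly z L L).coeff M := by
      rcases hc with ⟨rfl, rfl, rfl⟩ | ⟨rfl, rfl, rfl⟩
      · simpa using sphHarmonic_sub_half hM hl hn z
      · have := sphHarmonic_add_half hM hl hn z
        rw [show l + -1 * n = l - n by ring, show n - -1 / 2 = n + 1 / 2 by ring, this]
        simp
    have hd : ((Polynomial.C c₀ * Polynomial.X - Polynomial.C c₁) * genPoly z L L).natDegree
        < 2 * L + 2 := by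
      refine Polynomial.natDegree_mul_le.trans_lt ?_
      have : (Polynomial.C c₀ * Polynomial.X - Polynomial.C c₁).natDegree ≤ 1 := by
        compute_degree
      omega
    have hcs : star c₀ = c₀ ∧ star c₁ = c₁ := by
      rcases hc with ⟨-, rfl, rfl⟩ | ⟨-, rfl, rfl⟩ <;> simp
    have key' := congrArg star key
    rw [star_mul', star_mul', star_mul', hw _ hd, hr, hr, star_pow, star_inv₀, hr] at key'
    rw [key']
    simp only [Polynomial.eval_mul, star_mul', star_eval_genPoly, Polynomial.eval_sub,
      Polynomial.eval_C, Polynomial.eval_X, star_sub, hcs.1, hcs.2, star_natCast,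
      mul_assoc, ← Finset.mul_sum]
    ring

/-! ### Assembling the scalar products -/

lemma chiralPart_one (ψ : Spinor) (z : ℂ) : chiralPart 1 ψ z = ![ψ z 0, 0] := by
  ext i
  fin_cases i <;>
    simp [chiralPart, chirality, gamma_mul_gamma.2.2.1]
  ring

lemma chiralPart_neg_one (ψ : Spinor) (z : ℂ) : chiralPart (-1) ψ z = ![0, ψ z 1] := by
  ext i
  fin_cases i <;>
    simp [chiralPart, chirality, gamma_mul_gamma.2.2.1]
  ring

lemma measurable_density : Measurable fun z => ENNReal.ofReal (4 / q z ^ 2) :=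
  ENNReal.measurable_ofReal.comp
    (continuous_const.div (continuous_q.pow 2) fun z => (pow_pos (q_pos z) 2).ne').measurable

lemma density_smul (z : ℂ) (x : ℂ) :
    (ENNReal.ofReal (4 / q z ^ 2)).toReal • x = 4 * ((q z : ℂ)⁻¹) ^ 2 * x := by
  rw [ENNReal.toReal_ofReal (by have := q_pos z; positivity), Complex.real_smul]
  push_cast
  rw [div_eq_mul_inv, inv_pow]

lemma integrable_sphereMeasure_iff {g : ℂ → ℂ} :
    Integrable g sphereMeasure ↔ Integrable fun z => 4 * ((q z : ℂ)⁻¹) ^ 2 * g z := by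
  rw [sphereMeasure, integrable_withDensity_iff_integrable_smul' measurable_density
    (Filter.Eventually.of_forall fun z => ENNReal.ofReal_lt_top)]
  simp_rw [density_smul]

lemma integral_sphereMeasure (g : ℂ → ℂ) :
    ∫ z, g z ∂sphereMeasure = ∫ z, 4 * ((q z : ℂ)⁻¹) ^ 2 * g z := by
  rw [sphereMeasure, integral_withDensity_eq_integral_toReal_smul measurable_density
    (Filter.Eventually.of_forall fun z => ENNReal.ofReal_lt_top)]
  simp_rw [density_smul]

lemma inv_sqrt_two_sq : ((1 / √2 : ℝ) : ℂ) * ((1 / √2 : ℝ) : ℂ) = 1 / 2 := by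
  rw [← Complex.ofReal_mul, div_mul_div_comm, Real.mul_self_sqrt (by norm_num)]
  norm_num

lemma rpow_mul_rpow_half {L : ℕ} {l : ℝ} (hl : l = L + 1 / 2) (z : ℂ) :
    ((q z ^ (-l) : ℝ) : ℂ) * ((q z ^ (-(1 / 2) : ℝ) : ℝ) : ℂ) = ((q z : ℂ)⁻¹) ^ (L + 1) := by
  rw [← Complex.ofReal_mul, ← Real.rpow_add (q_pos z), ← rpow_neg_natCast, hl]
  congr 2
  push_cast; ring

/-- The constant in front of the integrands. -/
def pairingConst : ℂ := Complex.I / 2 * (√(1 / (2 * Real.pi)) : ℝ)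

lemma density_mul_pairing_pos {h : Sphere2 → ℝ} {X : ℂ → ℂ} {L : ℕ} {l n ε : ℝ} {c₀ c₁ : ℂ}
    (hF : ContDiff ℝ ∞ (pullback h)) (hX : IsHamiltonianField h X)
    (hl : l = L + 1 / 2) (hc : IsHalfWeight ε c₀ c₁) {d : ℕ} {w : ℕ → ℂ} (z : ℂ)
    (hw : star (spinHarmonic (1 / 2) l n z) = (q z ^ (-l) : ℝ) *
      ∑ i ∈ Finset.range d, w i * ((1 + star z * i) ^ L * (i - z) ^ (L + 1))) :
    4 * ((q z : ℂ)⁻¹) ^ 2 * spinorPairing (chiralPart 1 (eigenspinor l n))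
        (kosmannDeriv X (chiralPart 1 (eigenspinor (1 / 2) (ε / 2)))) z =
      pairingConst * ∑ i ∈ Finset.range d, w i * posInt c₀ c₁ i L (pullback h) z := by
  have hψ : ∀ z, chiralPart 1 (eigenspinor (1 / 2) (ε / 2)) z =
      ![((1 / √2 : ℝ) : ℂ) * ((√(1 / (2 * Real.pi)) : ℝ) : ℂ) * (c₀ + c₁ * star z) *
        (q z ^ (-(1 / 2) : ℝ) : ℝ), 0] := by
    intro z
    rw [chiralPart_one]
    simp only [eigenspinor, Pi.smul_apply, smul_eq_mul, Matrix.cons_val_zero,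
      (spinHarmonic_half_half hc z).1]
    ring_nf
  have hk := kosmannDeriv_pos hF hX _ c₀ c₁ hψ z
  have hq := q_cast_ne z
  have hq2 : ((q z : ℂ)⁻¹) ^ 2 * (q z : ℂ) ^ 2 = 1 := by field_simp
  have hp : spinorPairing (chiralPart 1 (eigenspinor l n))
      (kosmannDeriv X (chiralPart 1 (eigenspinor (1 / 2) (ε / 2)))) z =
      ((1 / √2 : ℝ) : ℂ) * star (spinHarmonic (1 / 2) l n z) *
        kosmannDeriv X (chiralPart 1 (eigenspinor (1 / 2) (ε / 2))) z 0 := by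
    simp [spinorPairing, chiralPart_one (eigenspinor l n), eigenspinor]
  have hS : ∑ i ∈ Finset.range d, w i * posInt c₀ c₁ i L (pullback h) z =
      ((q z : ℂ)⁻¹) ^ (L + 1) * (2 * (c₁ - c₀ * z) * (q z : ℂ)⁻¹ * dz (pullback h) z -
        (c₀ + c₁ * star z) * dz (dzbar (pullback h)) z) *
        ∑ i ∈ Finset.range d, w i * ((1 + star z * i) ^ L * (i - z) ^ (L + 1)) := by
    rw [Finset.mul_sum]
    refine Finset.sum_congr rfl fun i _ => ?_
    simp only [posInt, qmono]; ring
  have e := inv_sqrt_two_sq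
  rw [hp, hk, hw, hS, pairingConst, ← rpow_mul_rpow_half hl]
  generalize ∑ i ∈ Finset.range d, w i * ((1 + star z * i) ^ L * (i - z) ^ (L + 1)) = S
  generalize ((1 / √2 : ℝ) : ℂ) = k at *
  generalize (2 * (c₁ - c₀ * z) * (q z : ℂ)⁻¹ * dz (pullback h) z -
        (c₀ + c₁ * star z) * dz (dzbar (pullback h)) z) = B
  generalize ((√(1 / (2 * Real.pi)) : ℝ) : ℂ) = κ
  generalize ((q z ^ (-l) : ℝ) : ℂ) = a
  generalize ((q z ^ (-(1 / 2) : ℝ) : ℝ) : ℂ) = r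
  -- The constant is `4 · (1/√2)² · (i/4) = i/2`: density, normalization of the two spinors, Kosmann
  -- derivative.
  linear_combination (Complex.I * κ * S * B * a * r * (((q z : ℂ)⁻¹) ^ 2 * (q z : ℂ) ^ 2)) * e +
    (Complex.I * κ * S * B * a * r / 2) * hq2

lemma density_mul_pairing_neg {h : Sphere2 → ℝ} {X : ℂ → ℂ} {L : ℕ} {l n ε : ℝ} {c₀ c₁ : ℂ}
    (hF : ContDiff ℝ ∞ (pullback h)) (hX : IsHamiltonianField h X)
    (hl : l = L + 1 / 2) (hc : IsHalfWeight ε c₀ c₁) {d : ℕ} {w : ℕ → ℂ} (z : ℂ)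
    (hw : star (spinHarmonic (-(1 / 2)) l n z) = (q z ^ (-l) : ℝ) *
      ∑ i ∈ Finset.range d, w i * ((1 + star z * i) ^ (L + 1) * (i - z) ^ L)) :
    4 * ((q z : ℂ)⁻¹) ^ 2 * spinorPairing (chiralPart (-1) (eigenspinor l n))
        (kosmannDeriv X (chiralPart (-1) (eigenspinor (1 / 2) (ε / 2)))) z =
      pairingConst * ∑ i ∈ Finset.range d, w i * negInt c₀ c₁ i L (pullback h) z := by
  have hψ : ∀ z, chiralPart (-1) (eigenspinor (1 / 2) (ε / 2)) z =
      ![0, ((1 / √2 : ℝ) : ℂ) * Complex.I * ((√(1 / (2 * Real.pi)) : ℝ) : ℂ) * (c₀ * z - c₁) *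
        (q z ^ (-(1 / 2) : ℝ) : ℝ)] := by
    intro z
    rw [chiralPart_neg_one]
    simp only [eigenspinor, Pi.smul_apply, smul_eq_mul, Matrix.cons_val_one, Matrix.cons_val_zero,
      (spinHarmonic_half_half hc z).2]
    ring_nf
  have hk := kosmannDeriv_neg hF hX _ c₀ c₁ hψ z
  have hq := q_cast_ne z
  have hq2 : ((q z : ℂ)⁻¹) ^ 2 * (q z : ℂ) ^ 2 = 1 := by field_simp
  have hp : spinorPairing (chiralPart (-1) (eigenspinor l n))
      (kosmannDeriv X (chiralPart (-1) (eigenspinor (1 / 2) (ε / 2)))) z =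
      -(((1 / √2 : ℝ) : ℂ) * Complex.I) * star (spinHarmonic (-(1 / 2)) l n z) *
        kosmannDeriv X (chiralPart (-1) (eigenspinor (1 / 2) (ε / 2))) z 1 := by
    simp [spinorPairing, chiralPart_neg_one (eigenspinor l n), eigenspinor]
    left; ring
  have hS : ∑ i ∈ Finset.range d, w i * negInt c₀ c₁ i L (pullback h) z =
      ((q z : ℂ)⁻¹) ^ (L + 1) * (-(2 * (c₀ + c₁ * star z) * (q z : ℂ)⁻¹ * dzbar (pullback h) z) +
        (c₀ * z - c₁) * dz (dzbar (pullback h)) z) *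
        ∑ i ∈ Finset.range d, w i * ((1 + star z * i) ^ (L + 1) * (i - z) ^ L) := by
    rw [Finset.mul_sum]
    refine Finset.sum_congr rfl fun i _ => ?_
    simp only [negInt, qmono]; ring
  have e := inv_sqrt_two_sq
  rw [hp, hk, hw, hS, pairingConst, ← rpow_mul_rpow_half hl]
  generalize ∑ i ∈ Finset.range d, w i * ((1 + star z * i) ^ (L + 1) * (i - z) ^ L) = S
  generalize ((1 / √2 : ℝ) : ℂ) = k at *
  generalize (-(2 * (c₀ + c₁ * star z) * (q z : ℂ)⁻¹ * dzbar (pullback h) z) +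
        (c₀ * z - c₁) * dz (dzbar (pullback h)) z) = B
  generalize ((√(1 / (2 * Real.pi)) : ℝ) : ℂ) = κ
  generalize ((q z ^ (-l) : ℝ) : ℂ) = a
  generalize ((q z ^ (-(1 / 2) : ℝ) : ℝ) : ℂ) = r
  -- As for the positive half; the factors `i` of the two lower components multiply to `-i · i = 1`,
  -- the first one being conjugated.
  linear_combination (Complex.I * κ * S * B * a * r * (((q z : ℂ)⁻¹) ^ 2 * (q z : ℂ) ^ 2)) * e +
    (Complex.I * κ * S * B * a * r / 2) * hq2 -
    (Complex.I * κ * S * B * a * r * (((q z : ℂ)⁻¹) ^ 2 * (q z : ℂ) ^ 2) * k * k) * Complex.I_sq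

lemma density_mul_sphHarmonic {h : Sphere2 → ℝ} {L : ℕ} {l n ε : ℝ} {c₀ c₁ : ℂ} {d : ℕ}
    {w : ℕ → ℂ} (z : ℂ)
    (hw : ((√((l + ε * n) / l) : ℝ) : ℂ) * star (sphHarmonic (l - 1 / 2) (n - ε / 2) z) =
      ((q z : ℂ)⁻¹) ^ L * ∑ i ∈ Finset.range d,
        w i * ((c₀ * i - c₁) * ((1 + star z * i) ^ L * (i - z) ^ L))) :
    ((√((l + ε * n) / l) : ℝ) : ℂ) * (4 * ((q z : ℂ)⁻¹) ^ 2 *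
        (star (sphHarmonic (l - 1 / 2) (n - ε / 2) z) * ((h (stereo z) : ℝ) : ℂ))) =
      4 * ∑ i ∈ Finset.range d, w i * scalInt c₀ c₁ i L (pullback h) z := by
  have hS : ∑ i ∈ Finset.range d, w i * scalInt c₀ c₁ i L (pullback h) z =
      ((q z : ℂ)⁻¹) ^ 2 * ((h (stereo z) : ℝ) : ℂ) * (((q z : ℂ)⁻¹) ^ L *
        ∑ i ∈ Finset.range d, w i * ((c₀ * i - c₁) * ((1 + star z * i) ^ L * (i - z) ^ L))) := by
    rw [Finset.mul_sum, Finset.mul_sum]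
    refine Finset.sum_congr rfl fun i _ => ?_
    simp only [scalInt, qmono, pullback]; ring
  rw [hS, ← hw]
  ring

/-- The scalar spherical harmonics, including the vanishing ones with `|n| > l`, are bounded and
continuous. -/
lemma growth_sphHarmonic (L : ℕ) (n : ℝ) :
    Growth (sphHarmonic L n) 0 ∧ Continuous (sphHarmonic L n) := by
  have e : sphHarmonic L n = fun z => (((-1 : ℝ) ^ ⌊n⌋ *
      √((2 * L + 1) / (4 * Real.pi) * ((⌊(L : ℝ) + n⌋₊.factorial * ⌊(L : ℝ) - n⌋₊.factorial : ℝ) /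
          (L.factorial * L.factorial : ℝ))) : ℝ) : ℂ) *
      ∑ r ∈ Finset.range (L + 1), ∑ k ∈ Finset.range (L + 1),
        if (r : ℝ) - (k : ℝ) = n - 0 then
          ((L.choose r : ℂ) * (L.choose k : ℂ)) * (((q z : ℂ)⁻¹) ^ L * (z ^ r * (-star z) ^ k))
        else 0 := by
    funext z
    simp only [sphHarmonic, spinHarmonic, add_zero, sub_zero, Nat.floor_natCast]
    rw [Complex.ofReal_mul, rpow_neg_natCast, mul_assoc]
    congr 1
    rw [Finset.mul_sum]
    refine Finset.sum_congr rfl fun r _ => ?_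
    rw [Finset.mul_sum]
    refine Finset.sum_congr rfl fun k _ => ?_
    split_ifs
    · ring
    · simp
  have hsum : ∀ {s : Finset ℕ} {f : ℕ → ℂ → ℂ}, (∀ i ∈ s, Growth (f i) 0) →
      Growth (fun z => ∑ i ∈ s, f i z) 0 := by
    intro s f
    induction s using Finset.induction_on with
    | empty => intro _; simpa using growth_const 0
    | insert a s ha ih =>
      intro hf
      simp only [Finset.sum_insert ha]
      exact (hf a (by simp)).add (ih fun i hi => hf i (by simp [hi]))
  rw [e]
  constructor
  · refine Growth.const_mul _ (hsum fun r hr => hsum fun k hk => ?_)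
    have hr := Finset.mem_range.1 hr
    have hk := Finset.mem_range.1 hk
    split_ifs
    · refine Growth.const_mul _ (((growth_q_inv.pow L).mul
        ((growth_id.pow r).mul (growth_star.neg.pow k))).of_le ?_)
      omega
    · exact growth_const 0
  · have hc : Continuous fun z => (q z : ℂ)⁻¹ :=
      (Complex.continuous_ofReal.comp continuous_q).inv₀ q_cast_ne
    refine continuous_const.mul
      (continuous_finsetSum _ fun r _ => continuous_finsetSum _ fun k _ => ?_)
    split_ifs <;> fun_prop

/-- The difference of the scalar products, up to the normalization of the scalar harmonic. -/
theorem spinorL2_sub_eq {h : Sphere2 → ℝ} {X : ℂ → ℂ} {L M : ℕ} {l n ε : ℝ} {c₀ c₁ : ℂ}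
    (hF : SphereSmooth (pullback h)) (hX : IsHamiltonianField h X) (hM : M ≤ 2 * L + 1)
    (hl : l = L + 1 / 2) (hn : n = -l + M) (hc : IsHalfWeight ε c₀ c₁) :
    (Integrable (spinorPairing (chiralPart 1 (eigenspinor l n))
        (kosmannDeriv X (chiralPart 1 (eigenspinor (1 / 2) (ε / 2))))) sphereMeasure ∧
      Integrable (spinorPairing (chiralPart (-1) (eigenspinor l n))
        (kosmannDeriv X (chiralPart (-1) (eigenspinor (1 / 2) (ε / 2))))) sphereMeasure) ∧
    spinorL2 (chiralPart 1 (eigenspinor l n))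
        (kosmannDeriv X (chiralPart 1 (eigenspinor (1 / 2) (ε / 2)))) -
      spinorL2 (chiralPart (-1) (eigenspinor l n))
        (kosmannDeriv X (chiralPart (-1) (eigenspinor (1 / 2) (ε / 2)))) =
    pairingConst * (L * (L - 1)) * (((√((l + ε * n) / l) : ℝ) : ℂ) / 4 *
      scalarL2 (sphHarmonic (l - 1 / 2) (n - ε / 2)) (fun z => ((h (stereo z) : ℝ) : ℂ))) := by
  obtain ⟨w, hw⟩ := exists_harmonic_weights hM hl hn hc
  have ip : ∀ i ∈ Finset.range (2 * L + 2),
      Integrable fun z => w i * posInt c₀ c₁ i L (pullback h) z :=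
    fun i _ => (integrable_posInt hF c₀ c₁ i L).const_mul _
  have im : ∀ i ∈ Finset.range (2 * L + 2),
      Integrable fun z => w i * negInt c₀ c₁ i L (pullback h) z :=
    fun i _ => (integrable_negInt hF c₀ c₁ i L).const_mul _
  have is : ∀ i ∈ Finset.range (2 * L + 2),
      Integrable fun z => w i * scalInt c₀ c₁ i L (pullback h) z :=
    fun i _ => (integrable_scalInt hF c₀ c₁ i L).const_mul _
  have hp := fun z => density_mul_pairing_pos hF.contDiff hX hl hc z (hw z).1
  have hm := fun z => density_mul_pairing_neg hF.contDiff hX hl hc z (hw z).2.1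
  have hs := fun z => density_mul_sphHarmonic (h := h) z (hw z).2.2
  refine ⟨⟨?_, ?_⟩, ?_⟩
  · rw [integrable_sphereMeasure_iff]
    simp_rw [hp]
    exact (integrable_finsetSum _ ip).const_mul _
  · rw [integrable_sphereMeasure_iff]
    simp_rw [hm]
    exact (integrable_finsetSum _ im).const_mul _
  -- The factor 4 of the density is explicit here but absorbed into `pairingConst` on the spinor
  -- side; this is the `1/4` of the statement.
  · have hsc : ((√((l + ε * n) / l) : ℝ) : ℂ) *
        scalarL2 (sphHarmonic (l - 1 / 2) (n - ε / 2)) (fun z => ((h (stereo z) : ℝ) : ℂ)) =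
        4 * ∑ i ∈ Finset.range (2 * L + 2), w i * ∫ z, scalInt c₀ c₁ i L (pullback h) z := by
      rw [scalarL2, integral_sphereMeasure, ← integral_const_mul]
      simp_rw [hs]
      rw [integral_const_mul, integral_finsetSum _ is]
      simp_rw [integral_const_mul]
    rw [div_mul_eq_mul_div, hsc, spinorL2, spinorL2, integral_sphereMeasure,
      integral_sphereMeasure]
    simp_rw [hp, hm]
    rw [integral_const_mul, integral_const_mul, integral_finsetSum _ ip, integral_finsetSum _ im,
      ← mul_sub, ← Finset.sum_sub_distrib]
    simp_rw [integral_const_mul, ← mul_sub, integral_posInt_sub_negInt hF]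
    rw [mul_div_cancel_left₀ _ (by norm_num : (4 : ℂ) ≠ 0), mul_assoc pairingConst]
    congr 1
    rw [Finset.mul_sum]
    exact Finset.sum_congr rfl fun i _ => by ring

lemma integrable_sphHarmonic_mul {h : Sphere2 → ℝ} (hF : SphereSmooth (pullback h)) (L : ℕ)
    (n : ℝ) :
    Integrable (fun z => star (sphHarmonic L n z) * ((h (stereo z) : ℝ) : ℂ)) sphereMeasure := by
  rw [integrable_sphereMeasure_iff]
  obtain ⟨hg, hc⟩ := growth_sphHarmonic L n
  have hg' : Growth (fun z => star (sphHarmonic L n z)) 0 := by simpa [Growth] using hg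
  apply Growth.integrable
  · exact (((growth_q_inv.pow 2).const_mul 4).mul (hg'.mul hF.growth)).of_le (by norm_num)
  · have h1 : Continuous fun z => (q z : ℂ)⁻¹ :=
      (Complex.continuous_ofReal.comp continuous_q).inv₀ q_cast_ne
    have h2 : Continuous fun z => ((h (stereo z) : ℝ) : ℂ) := hF.contDiff.continuous
    fun_prop

end SpinSphere

end

/-! ### The proposition -/

theorem mainTheorem7
    (h : SpinSphere.Sphere2 → ℝ) (hh : ContMDiff (𝓡 2) 𝓘(ℝ, ℝ) ∞ h)
    (X : ℂ → ℂ) (hX : SpinSphere.IsHamiltonianField h X)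
    (l n : ℝ) (hl : ∃ j : ℕ, l = (j : ℝ) + 1 / 2)
    (hn : ∃ m : ℕ, n = -l + (m : ℝ) ∧ n ≤ l)
    (ε : ℝ) (hε : ε = 1 ∨ ε = -1) :
    (∀ σ : ℂ, σ = 1 ∨ σ = -1 →
      Integrable
        (SpinSphere.spinorPairing
          (SpinSphere.chiralPart σ (SpinSphere.eigenspinor l n))
          (SpinSphere.kosmannDeriv X
            (SpinSphere.chiralPart σ (SpinSphere.eigenspinor (1 / 2) (ε / 2)))))
        SpinSphere.sphereMeasure) ∧
    Integrable
      (fun z => star (SpinSphere.sphHarmonic (l - 1 / 2) (n - ε / 2) z) *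
        ((h (SpinSphere.stereo z) : ℝ) : ℂ))
      SpinSphere.sphereMeasure ∧
    SpinSphere.spinorL2
        (SpinSphere.chiralPart 1 (SpinSphere.eigenspinor l n))
        (SpinSphere.kosmannDeriv X
          (SpinSphere.chiralPart 1 (SpinSphere.eigenspinor (1 / 2) (ε / 2)))) -
      SpinSphere.spinorL2
        (SpinSphere.chiralPart (-1) (SpinSphere.eigenspinor l n))
        (SpinSphere.kosmannDeriv X
          (SpinSphere.chiralPart (-1) (SpinSphere.eigenspinor (1 / 2) (ε / 2)))) =
    Complex.I / 8 *
        ((√((l + ε * n) / (2 * Real.pi * l)) * (l - 3 / 2) * (l - 1 / 2) : ℝ) : ℂ) *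
      SpinSphere.scalarL2
        (SpinSphere.sphHarmonic (l - 1 / 2) (n - ε / 2))
        (fun z => ((h (SpinSphere.stereo z) : ℝ) : ℂ)) := by
  obtain ⟨L, hl⟩ := hl
  obtain ⟨M, hn, hnl⟩ := hn
  have hM : M ≤ 2 * L + 1 := by
    have : (M : ℝ) ≤ 2 * L + 1 := by linarith
    exact_mod_cast this
  have hF := SpinSphere.sphereSmooth_pullback hh
  obtain ⟨c₀, c₁, hc⟩ : ∃ c₀ c₁ : ℂ, SpinSphere.IsHalfWeight ε c₀ c₁ := by
    rcases hε with hε | hε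
    · exact ⟨1, 0, Or.inl ⟨hε, rfl, rfl⟩⟩
    · exact ⟨0, 1, Or.inr ⟨hε, rfl, rfl⟩⟩
  obtain ⟨⟨ip, im⟩, e⟩ := SpinSphere.spinorL2_sub_eq hF hX hM hl hn hc
  refine ⟨?_, ?_, ?_⟩
  · rintro σ (rfl | rfl)
    · exact ip
    · exact im
  · rw [show l - 1 / 2 = L by rw [hl]; ring]
    exact SpinSphere.integrable_sphHarmonic_mul hF L _
  · have hsq : √((l + ε * n) / (2 * Real.pi * l)) =
        √(1 / (2 * Real.pi)) * √((l + ε * n) / l) := by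
      rw [← Real.sqrt_mul (by positivity), div_mul_div_comm, one_mul]
    -- The `1/8` is `1/2` from `pairingConst` times `1/4`, and `L * (L - 1)` is `(l - 1/2) * (l -
    -- 3/2)`.
    rw [e, hsq, SpinSphere.pairingConst, hl]
    push_cast
    ring
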